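/- All alphabets are finite and all logarithms are to base $2$; $|a|^+:=\max\{a,0\}$. Let $W:\mathcal X\to\mathcal Y\times\mathcal Z$ be a discrete memoryless broadcast channel with $\mathcal Y$-marginal $W_{\mathcal Y}$, let $\mathcal U$ be a finite set, let $P_{UX}$ be a probability distribution on $\mathcal U\times\mathcal X$, and let $R_1,R_2\ge 0$, $R_{12}:=R_1+R_2$. The messages $M_1,M_2$ are uniform and independent on $\mathcal M_j=\{1,\dots,\lceil 2^{nR_j}\rceil\}$. An $(n,R_1,R_2)$-code consists of an encoder $f:\mathcal M_1\times\mathcal M_2\to\mathcal X^n$, a decoder $\varphi_1:\mathcal Y^n\to(\mathcal M_1\cup\{\mathrm e_1\})\times(\mathcal M_2\cup\{\mathrm e_2\})$ at the main terminal $\mathcal Y$ and a decoder $\varphi_2:\mathcal Z^n\to\mathcal M_2\cup\{\mathrm e_2\}$, where $\mathrm e_j$ denotes an erasure. For $j=1,2$ let $e_j$ be the probability that the $j$-th component of $\varphi_1(Y^n)$ is not $M_j$ (total error), and let $\hat e_j$ be the probability that it is an element of $\mathcal M_j\setminus\{M_j\}$ (undetected error), both averaged over the messages. Superposition code and decoder.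 A codebook consists of cloud centers $\mathbf u(m_2)\in\mathcal U^n$ and satellite codewords $\mathbf x(m_1,m_2)\in\mathcal X^n$; the encoder sends $\mathbf x(m_1,m_2)$. Let $\hat I$ denote empirical mutual information. Given $\tilde R_j\ge R_j$ $(j=1,2)$ and $\lambda_{12},\lambda_2\ge1$, put $\tilde R_{12}:=\tilde R_1+\tilde R_2$; the two-step decoder at $\mathcal Y$ works as follows. Step 1: output $(\hat m_1,\hat m_2)$ if it is the unique pair with $$\hat I(\mathbf u(\hat m_2),\mathbf x(\hat m_1,\hat m_2)\wedge\mathbf y)\ge\tilde R_{12}+\lambda_{12}\big|\hat I(\mathbf u(\tilde m_2),\mathbf x(\tilde m_1,\tilde m_2)\wedge\mathbf y)-R_{12}\big|^+\quad\text{for all }(\tilde m_1,\tilde m_2)\ne(\hat m_1,\hat m_2).$$ Step 2: if there is no such unique pair, output $(\mathrm e_1,\hat m_2)$ if $\hat m_2$ is the unique message with $$\hat I(\mathbf u(\hat m_2)\wedge\mathbf y)\ge\tilde R_2+\lambda_2\big|\hat I(\mathbf u(\tilde m_2)\wedge\mathbf y)-R_2\big|^+\quad\text{for all }\tilde m_2\ne\hat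 m_2,$$ and output $(\mathrm e_1,\mathrm e_2)$ if there is no such unique message. Exponents. For stochastic matrices $V:\mathcal U\times\mathcal X\to\mathcal Y$ and $\hat V:\mathcal U\to\mathcal Y$ let $I_V$ and $I_{\hat V}$ denote mutual information under the joint laws $P_{UX}\times V$ and $P_U\times\hat V$. Let $D(\cdot\|\cdot|\cdot)$ be the conditional divergence, let $W(y|u,x):=W_{\mathcal Y}(y|x)$ and $W_{Y|U}(y|u):=\sum_xW_{\mathcal Y}(y|x)P_{X|U}(x|u)$. Define, for $\lambda>0$ and real $a_1,a_2,b$, $$E_{\mathrm r,\lambda}(a_2):=\min_{\hat V}\Big[D(\hat V\|W_{Y|U}|P_U)+\lambda\,|I_{\hat V}(U\wedge Y)-a_2|^+\Big],$$ $$E_{\mathrm r,\lambda}(a_1,a_2):=\min_V\Big[D(V\|W|P_{UX})+\lambda\,|I_V(UX\wedge Y)-a_1-a_2|^+\Big],$$ $$E^-_{\mathrm r,\lambda}(a_1,a_2,b):=\min_V\Big[D(V\|W|P_{UX})+\lambda\,|I_V(UX\wedge Y)-a_1-a_2|^+-|I_V(U\wedge Y)-b|^+\Big],$$ and $\Delta_{12}:=\tilde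 R_{12}-R_{12}$, $\Delta_2:=\tilde R_2-R_2$. Theorem. For every $W$, $P_{UX}$, $R_1$, $R_2$ as above there is a sequence of superposition codebooks, one for each blocklength $n$, in which all pairs $(\mathbf u(m_2),\mathbf x(m_1,m_2))$ have one and the same joint type, these types converging to $P_{UX}$ as $n\to\infty$, such that for every choice of $\tilde R_1\ge R_1$, $\tilde R_2\ge R_2$, $\lambda_{12}\ge1$, $\lambda_2\ge1$ the $(n,R_1,R_2)$-codes formed by these codebooks and the corresponding two-step decoder at $\mathcal Y$ (and any decoder at $\mathcal Z$) satisfy $$\liminf_{n\to\infty}\tfrac1n\log\tfrac1{e_1}\ge E^-_{\mathrm r,1/\lambda_{12}}(\tilde R_1,\tilde R_2,R_2),$$ $$\liminf_{n\to\infty}\tfrac1n\log\tfrac1{\hat e_1}\ge E^-_{\mathrm r,\lambda_{12}}(R_1,R_2,R_2)+\Delta_{12},$$ $$\liminf_{n\to\infty}\tfrac1n\log\tfrac1{e_2}\ge\min\Big\{E_{\mathrm r,\lambda_{12}}(R_1,R_2)+\Delta_{12},\ \max\big\{E^-_{\mathrm r,1/\lambda_{12}}(\tilde R_1,\tilde R_2,R_2),\,E_{\mathrm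 r,1/\lambda_2}(\tilde R_2)\big\}\Big\},$$ $$\liminf_{n\to\infty}\tfrac1n\log\tfrac1{\hat e_2}\ge\min\Big\{E_{\mathrm r,\lambda_{12}}(R_1,R_2)+\Delta_{12},\ \max\big\{E^-_{\mathrm r,1/\lambda_{12}}(\tilde R_1,\tilde R_2,R_2),\,E_{\mathrm r,\lambda_2}(R_2)+\Delta_2\big\}\Big\},$$ where $\log(1/0):=+\infty$. -/

import Mathlib

open Filter Topology

noncomputable section

namespace ABC

/-! ### Finite-alphabet information quantities (all logarithms are to base 2) -/

section Info

variable {α β : Type*} [Fintype α] [Fintype β]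

/-- The joint distribution `P × V` of an input law `P` and a stochastic matrix `V`. -/
def joint (P : α → ℝ) (V : α → β → ℝ) : α × β → ℝ := fun p => P p.1 * V p.1 p.2

/-- First marginal. -/
def fstMarg (Q : α × β → ℝ) : α → ℝ := fun a => ∑ b, Q (a, b)

/-- Second marginal. -/
def sndMarg (Q : α × β → ℝ) : β → ℝ := fun b => ∑ a, Q (a, b)

/-- Mutual information of a joint distribution `Q` on `α × β`
(terms with `Q (a, b) = 0` contribute `0`). -/
def mutualInfo (Q : α × β → ℝ) : ℝ :=
  ∑ a, ∑ b, Q (a, b) * Real.logb 2 (Q (a, b) / (fstMarg Q a * sndMarg Q b))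

open Classical in
/-- Conditional divergence `D(V ‖ W | P)`; it is `⊤` unless `V(·|a) ≪ W(·|a)`
for every `a` with `P a ≠ 0`. -/
def condKL (V W : α → β → ℝ) (P : α → ℝ) : EReal :=
  if ∀ a b, P a ≠ 0 → W a b = 0 → V a b = 0 then
    ((∑ a, P a * ∑ b, V a b * Real.logb 2 (V a b / W a b) : ℝ) : EReal)
  else ⊤

end Info

/-! ### Types of sequences -/

open Classical in
/-- The type (empirical distribution) of a sequence. -/
def seqType {α : Type*} {n : ℕ} (s : Fin n → α) : α → ℝ :=
  fun a => ((Finset.univ.filter fun i => s i = a).card : ℝ) / n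

/-- Two sequences regarded as one sequence of pairs. -/
def pairSeq {α β : Type*} {n : ℕ} (s : Fin n → α) (t : Fin n → β) : Fin n → α × β :=
  fun i => (s i, t i)

/-- Empirical mutual information of two sequences. -/
def empInfo {α β : Type*} [Fintype α] [Fintype β] {n : ℕ}
    (s : Fin n → α) (t : Fin n → β) : ℝ :=
  mutualInfo (seqType (pairSeq s t))

/-! ### Codes and error probabilities -/

/-- The message set with `⌈2 ^ (n R)⌉` elements. -/
abbrev Msg (n : ℕ) (R : ℝ) : Type := Fin ⌈(2 : ℝ) ^ ((n : ℝ) * R)⌉₊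

/-- An `(n, R₁, R₂)`-code for a broadcast channel with degraded message sets;
`none` is the erasure symbol. -/
structure Code (X Y Z : Type*) (n : ℕ) (R₁ R₂ : ℝ) where
  enc : Msg n R₁ → Msg n R₂ → Fin n → X
  decY : (Fin n → Y) → Option (Msg n R₁) × Option (Msg n R₂)
  decZ : (Fin n → Z) → Option (Msg n R₂)

/-- The `Y`-marginal of the broadcast channel. -/
def margY {X Y Z : Type*} [Fintype Y] [Fintype Z]
    (W : X → stdSimplex ℝ (Y × Z)) : X → Y → ℝ :=
  fun x => fstMarg (W x)

/-- `WYⁿ(D | x)` for the memoryless channel with transition matrix `WY`. -/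
def blockProb {X Y : Type*} [Fintype Y] {n : ℕ} (WY : X → Y → ℝ)
    (x : Fin n → X) (D : Set (Fin n → Y)) : ℝ :=
  ∑ y, D.indicator (fun y => ∏ i, WY (x i) (y i)) y

namespace Code

variable {X Y Z : Type*} [Fintype Y] {n : ℕ} {R₁ R₂ : ℝ}

/-- Decoding region of `m₁` at terminal `Y`. -/
def region₁ (c : Code X Y Z n R₁ R₂) (m₁ : Msg n R₁) : Set (Fin n → Y) :=
  {y | (c.decY y).1 = some m₁}

/-- Decoding region of `m₂` at terminal `Y` (message 1 may be decoded or erased). -/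
def region₂ (c : Code X Y Z n R₁ R₂) (m₂ : Msg n R₂) : Set (Fin n → Y) :=
  {y | (c.decY y).2 = some m₂}

/-- Average over a uniform pair of messages. -/
def avg (f : Msg n R₁ → Msg n R₂ → ℝ) : ℝ :=
  (∑ m₁, ∑ m₂, f m₁ m₂) / (Fintype.card (Msg n R₁) * Fintype.card (Msg n R₂))

/-- Average total (undetected or erased) error probability of message 1 at `Y`. -/
def totalErr₁ (c : Code X Y Z n R₁ R₂) (WY : X → Y → ℝ) : ℝ :=
  avg fun m₁ m₂ => blockProb WY (c.enc m₁ m₂) (c.region₁ m₁)ᶜ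

/-- Average undetected error probability of message 1 at `Y`. -/
def undetErr₁ (c : Code X Y Z n R₁ R₂) (WY : X → Y → ℝ) : ℝ :=
  avg fun m₁ m₂ => blockProb WY (c.enc m₁ m₂) (⋃ m ∈ {m | m ≠ m₁}, c.region₁ m)

/-- Average total (undetected or erased) error probability of message 2 at `Y`. -/
def totalErr₂ (c : Code X Y Z n R₁ R₂) (WY : X → Y → ℝ) : ℝ :=
  avg fun m₁ m₂ => blockProb WY (c.enc m₁ m₂) (c.region₂ m₂)ᶜ

/-- Average undetected error probability of message 2 at `Y`. -/
def undetErr₂ (c : Code X Y Z n R₁ R₂) (WY : X → Y → ℝ) : ℝ :=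
  avg fun m₁ m₂ => blockProb WY (c.enc m₁ m₂) (⋃ m ∈ {m | m ≠ m₂}, c.region₂ m)

end Code

open Classical in
/-- `(1/n) log₂ (1/p)`, with value `⊤` for `p = 0`. -/
def expo (n : ℕ) (p : ℝ) : EReal :=
  if p = 0 then ⊤ else ((1 / (n : ℝ) * Real.logb 2 (1 / p) : ℝ) : EReal)

/-! ### Superposition codebooks and the two-step erasure decoder -/

/-- A superposition codebook: cloud centers `u m₂` and satellite codewords `x m₁ m₂`. -/
structure Codebook (U X : Type*) (n : ℕ) (R₁ R₂ : ℝ) where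
  u : Msg n R₂ → Fin n → U
  x : Msg n R₁ → Msg n R₂ → Fin n → X

namespace Codebook

variable {U X Y Z : Type*} [Fintype U] [Fintype X] [Fintype Y] {n : ℕ} {R₁ R₂ : ℝ}

/-- `Î(u(m₂), x(m₁, m₂) ∧ y)`. -/
def info₁₂ (C : Codebook U X n R₁ R₂) (y : Fin n → Y) (m : Msg n R₁ × Msg n R₂) : ℝ :=
  empInfo (pairSeq (C.u m.2) (C.x m.1 m.2)) y

/-- `Î(u(m₂) ∧ y)`. -/
def info₂ (C : Codebook U X n R₁ R₂) (y : Fin n → Y) (m₂ : Msg n R₂) : ℝ :=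
  empInfo (C.u m₂) y

/-- The pair `m` passes the test of Step 1. -/
def Step₁ (C : Codebook U X n R₁ R₂) (S₁ S₂ l₁₂ : ℝ) (y : Fin n → Y)
    (m : Msg n R₁ × Msg n R₂) : Prop :=
  ∀ m', m' ≠ m →
    C.info₁₂ y m ≥ (S₁ + S₂) + l₁₂ * max (C.info₁₂ y m' - (R₁ + R₂)) 0

/-- The message `m` passes the test of Step 2. -/
def Step₂ (C : Codebook U X n R₁ R₂) (S₂ l₂ : ℝ) (y : Fin n → Y) (m : Msg n R₂) : Prop :=
  ∀ m', m' ≠ m → C.info₂ y m ≥ S₂ + l₂ * max (C.info₂ y m' - R₂) 0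

open Classical in
/-- The two-step erasure decoder with thresholds `S₁, S₂` and parameters `l₁₂, l₂`. -/
def twoStep (C : Codebook U X n R₁ R₂) (S₁ S₂ l₁₂ l₂ : ℝ) (y : Fin n → Y) :
    Option (Msg n R₁) × Option (Msg n R₂) :=
  if h : ∃! m, C.Step₁ S₁ S₂ l₁₂ y m then (some h.exists.choose.1, some h.exists.choose.2)
  else if h : ∃! m, C.Step₂ S₂ l₂ y m then (none, some h.exists.choose)
  else (none, none)

/-- The code with satellite codewords as channel inputs, the two-step decoder at terminal `Y`
and the decoder `φ` at terminal `Z`. -/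
def code (C : Codebook U X n R₁ R₂) (S₁ S₂ l₁₂ l₂ : ℝ)
    (φ : (Fin n → Z) → Option (Msg n R₂)) : Code X Y Z n R₁ R₂ where
  enc := C.x
  decY := C.twoStep S₁ S₂ l₁₂ l₂
  decZ := φ

end Codebook

/-! ### Exponents -/

section Exponents

variable {U X Y : Type*} [Fintype U] [Fintype X] [Fintype Y]

/-- The channel `(u, x) ↦ WY(· | x)`. -/
def chanUX (WY : X → Y → ℝ) : U × X → Y → ℝ := fun p => WY p.2

/-- The averaged channel `W_{Y|U}(y|u) = ∑ₓ WY(y|x) P_{X|U}(x|u)`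
(only its rows with `P_U(u) > 0` are ever used). -/
def chanU (P : U × X → ℝ) (WY : X → Y → ℝ) : U → Y → ℝ :=
  fun u y => ∑ x, WY x y * (P (u, x) / fstMarg P u)

/-- The law of `(U, Y)` under `P_{UX} × V`. -/
def jointUY (P : U × X → ℝ) (V : U × X → Y → ℝ) : U × Y → ℝ :=
  fun p => ∑ x, P (p.1, x) * V (p.1, x) p.2

/-- `J_V(R₁, R₂) = |I_V(UX ∧ Y) - R₁ - R₂|⁺`. -/
def J₁₂ (P : U × X → ℝ) (V : U × X → Y → ℝ) (R₁ R₂ : ℝ) : ℝ :=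
  max (mutualInfo (joint P V) - (R₁ + R₂)) 0

/-- `|I(U ∧ Y) - R₂|⁺` for a joint law `Q` of `(U, Y)`. -/
def J₂ (Q : U × Y → ℝ) (R₂ : ℝ) : ℝ := max (mutualInfo Q - R₂) 0

/-- Marginal modified random coding exponent `E_{r,l}(R₂)`. -/
def Er₂ (P : U × X → ℝ) (WY : X → Y → ℝ) (l R₂ : ℝ) : EReal :=
  ⨅ V : U → stdSimplex ℝ Y,
    condKL (fun u => V u) (chanU P WY) (fstMarg P) +
      ((l * J₂ (joint (fstMarg P) fun u => V u) R₂ : ℝ) : EReal)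

/-- Joint modified random coding exponent `E_{r,l}(R₁, R₂)`. -/
def Er₁₂ (P : U × X → ℝ) (WY : X → Y → ℝ) (l R₁ R₂ : ℝ) : EReal :=
  ⨅ V : U × X → stdSimplex ℝ Y,
    condKL (fun p => V p) (chanUX WY) P +
      ((l * J₁₂ P (fun p => V p) R₁ R₂ : ℝ) : EReal)

/-- Penalized modified random coding exponent `E⁻_{r,l}(R₁, R₂, R)`. -/
def ErPen (P : U × X → ℝ) (WY : X → Y → ℝ) (l R₁ R₂ R : ℝ) : EReal :=
  ⨅ V : U × X → stdSimplex ℝ Y,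
    condKL (fun p => V p) (chanUX WY) P +
      ((l * J₁₂ P (fun p => V p) R₁ R₂ - J₂ (jointUY P fun p => V p) R : ℝ) : EReal)

end Exponents

end ABC

end

/-!
Fix a pair of sequences `(u, x)` of type close to `P` and permute positions at random: one
permutation per cloud, and within it one permutation fixing `u` per satellite. All codeword pairs
then have the type of `(u, x)`. If `(u, x)` is permuted independently of `y`, then
`2 ^ (n Î(u, x ∧ y))` is a likelihood ratio up to a polynomial factor, so its expectation is
polynomial in `n`; the same holds for `u` alone, and conditionally on `u` for the satellites.
Hence the mean of one functional of the codebook, its *score*, grows only polynomially, and some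
codebook attains this mean. The score depends neither on the channel nor on the thresholds of the
decoder, which is why one sequence of codebooks serves all of them.

For a fixed channel, the probability of `y` given the transmitted pair is, up to the conditional
type's likelihood used as the weight in the score, `2 ^ (-n D(V ‖ W | P))` with `V` the conditional
type. If an error event forces the score to be at least `2 ^ (n Φ)`, with `Φ` a function of the
joint type of `(u, x, y)`, its exponent is therefore at least `min_V [D(V ‖ W | P) + Φ]`, where
lower semicontinuity allows the passage to the limit type. The inequalities defining the erasure
tests provide such a `Φ` for every error event.
-/

noncomputable section

namespace ABC

open Finset BigOperators
open scoped Nat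

section Counting

variable {α β γ : Type*} {n : ℕ}

open Classical in
/-- The number of occurrences of the letter `a` in the sequence `s`. -/
def letterCount (s : Fin n → α) (a : α) : ℕ := #{i | s i = a}

theorem seqType_eq_letterCount_div (s : Fin n → α) (a : α) :
    seqType s a = (letterCount s a : ℝ) / n := rfl

theorem letterCount_pos (s : Fin n → α) (i : Fin n) : 0 < letterCount s (s i) :=
  card_pos.2 ⟨i, by simp⟩

theorem letterCount_ne_zero_iff {s : Fin n → α} {a : α} :
    letterCount s a ≠ 0 ↔ ∃ i, s i = a := by
  simp [letterCount]

theorem letterCount_le (s : Fin n → α) (a : α) : letterCount s a ≤ n :=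
  (card_le_univ _).trans (Fintype.card_fin n).le

theorem letterCount_comp_perm (s : Fin n → α) (σ : Equiv.Perm (Fin n)) :
    letterCount (s ∘ σ) = letterCount s := by
  funext a
  exact card_equiv σ (by simp)

theorem letterCount_comp_injective {f : α → β} (hf : Function.Injective f) (s : Fin n → α) (a : α) :
    letterCount (f ∘ s) (f a) = letterCount s a := by
  refine congrArg card ?_
  ext i
  simp [hf.eq_iff]

theorem letterCount_pairSeq_swap (s : Fin n → α) (t : Fin n → β) (a : α) (b : β) :
    letterCount (pairSeq t s) (b, a) = letterCount (pairSeq s t) (a, b) :=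
  letterCount_comp_injective Prod.swap_injective (pairSeq s t) (a, b)

theorem letterCount_pairSeq_right_comm (s : Fin n → α) (t : Fin n → β) (r : Fin n → γ)
    (a : α) (b : β) (c : γ) :
    letterCount (pairSeq (pairSeq s r) t) ((a, c), b) =
      letterCount (pairSeq (pairSeq s t) r) ((a, b), c) :=
  letterCount_comp_injective (f := fun p : (α × β) × γ => ((p.1.1, p.2), p.1.2))
    (fun p q h => by simp only [Prod.mk.injEq] at h; ext <;> simp [h])
    (pairSeq (pairSeq s t) r) ((a, b), c)

theorem sum_letterCount_pairSeq_right [Fintype β] (s : Fin n → α) (t : Fin n → β) (a : α) :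
    ∑ b, letterCount (pairSeq s t) (a, b) = letterCount s a := by
  classical
  simp only [letterCount, pairSeq, Prod.mk.injEq, ← filter_filter]
  exact (card_eq_sum_card_fiberwise (by simp)).symm

theorem sum_letterCount_pairSeq_left [Fintype α] (s : Fin n → α) (t : Fin n → β) (b : β) :
    ∑ a, letterCount (pairSeq s t) (a, b) = letterCount t b := by
  simp only [← letterCount_pairSeq_swap s t, sum_letterCount_pairSeq_right]

theorem sum_comp_eq_sum_letterCount_mul [Fintype α] (s : Fin n → α) (f : α → ℝ) :
    ∑ i, f (s i) = ∑ a, (letterCount s a : ℝ) * f a := by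
  classical
  rw [← sum_fiberwise' univ s f]
  simp [letterCount]

theorem prod_comp_eq_prod_pow_letterCount [Fintype α] (s : Fin n → α) (f : α → ℝ) :
    ∏ i, f (s i) = ∏ a, f a ^ letterCount s a := by
  classical
  rw [← prod_fiberwise' univ s f]
  simp [letterCount]

theorem sum_letterCount [Fintype α] (s : Fin n → α) : ∑ a, (letterCount s a : ℝ) = n := by
  simpa using (sum_comp_eq_sum_letterCount_mul s fun _ => 1).symm

theorem seqType_comp_perm (s : Fin n → α) (σ : Equiv.Perm (Fin n)) :
    seqType (s ∘ σ) = seqType s := by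
  funext a
  simp only [seqType_eq_letterCount_div, letterCount_comp_perm]

theorem seqType_nonneg (s : Fin n → α) (a : α) : 0 ≤ seqType s a := by
  rw [seqType_eq_letterCount_div]; positivity

theorem mul_sum_seqType_mul [Fintype α] (s : Fin n → α) (f : α → ℝ) :
    n * ∑ a, seqType s a * f a = ∑ i, f (s i) := by
  rcases eq_or_ne n 0 with rfl | hn
  · simp
  · rw [sum_comp_eq_sum_letterCount_mul, mul_sum]
    refine sum_congr rfl fun a _ => ?_
    rw [seqType_eq_letterCount_div, ← mul_assoc, mul_div_cancel₀ _ (by exact_mod_cast hn)]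

theorem fstMarg_seqType_pairSeq [Fintype β] (s : Fin n → α) (t : Fin n → β) :
    fstMarg (seqType (pairSeq s t)) = seqType s := by
  funext a
  simp only [fstMarg, seqType_eq_letterCount_div, ← sum_div]
  exact_mod_cast congrArg (fun k : ℕ => (k : ℝ) / n) (sum_letterCount_pairSeq_right s t a)

theorem sndMarg_seqType_pairSeq [Fintype α] (s : Fin n → α) (t : Fin n → β) :
    sndMarg (seqType (pairSeq s t)) = seqType t := by
  funext b
  simp only [sndMarg, seqType_eq_letterCount_div, ← sum_div]
  exact_mod_cast congrArg (fun k : ℕ => (k : ℝ) / n) (sum_letterCount_pairSeq_left s t b)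

/-- The likelihood of the sequence `t` given `s` under their conditional type: if `t` has
conditional type `V` given `s`, it is `∏ i, V (t i | s i)`. -/
def condLik (s : Fin n → γ) (t : Fin n → α) : ℝ :=
  ∏ i, (letterCount (pairSeq s t) (s i, t i) : ℝ) / letterCount s (s i)

theorem condLik_pos (s : Fin n → γ) (t : Fin n → α) : 0 < condLik s t :=
  prod_pos fun i _ => div_pos (by exact_mod_cast letterCount_pos (pairSeq s t) i)
    (by exact_mod_cast letterCount_pos s i)

theorem condLik_comp_perm (s : Fin n → γ) (t : Fin n → α) (σ : Equiv.Perm (Fin n)) :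
    condLik (s ∘ σ) (t ∘ σ) = condLik s t := by
  have h : pairSeq (s ∘ σ) (t ∘ σ) = pairSeq s t ∘ σ := rfl
  simp only [condLik, h, letterCount_comp_perm, Function.comp_apply]
  exact Equiv.prod_comp σ fun i => (letterCount (pairSeq s t) (s i, t i) : ℝ) / letterCount s (s i)

theorem condLik_const (t : Fin n → α) :
    condLik (fun _ => ()) t = ∏ i, (letterCount t (t i) : ℝ) / n := by
  refine prod_congr rfl fun i _ => ?_
  congr 2
  · exact letterCount_comp_injective (Prod.mk_right_injective ()) t (t i)
  · simp [letterCount]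

/-- A common form for the factors polynomial in the blocklength `n` that the method of types
produces. -/
def polyFactor (n d : ℕ) : ℝ := (3 * ((n : ℝ) + 1)) ^ d

theorem one_le_polyBase (n : ℕ) : 1 ≤ 3 * ((n : ℝ) + 1) := by
  have : (0 : ℝ) ≤ n := n.cast_nonneg
  linarith

theorem polyFactor_pos (n d : ℕ) : 0 < polyFactor n d :=
  pow_pos (zero_lt_one.trans_le (one_le_polyBase n)) d

theorem polyFactor_mono (n : ℕ) {d e : ℕ} (h : d ≤ e) : polyFactor n d ≤ polyFactor n e :=
  pow_le_pow_right₀ (one_le_polyBase n) h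

theorem polyFactor_add (n d e : ℕ) : polyFactor n (d + e) = polyFactor n d * polyFactor n e :=
  pow_add _ _ _

variable [Fintype α]

theorem sum_prod_letterCount_div_eq_one (s : Fin n → γ) (t : Fin n → α) :
    ∑ t' : Fin n → α, ∏ i, (letterCount (pairSeq s t) (s i, t' i) : ℝ) / letterCount s (s i) =
      1 := by
  rw [← Fintype.prod_sum fun i a => (letterCount (pairSeq s t) (s i, a) : ℝ) / letterCount s (s i)]
  refine prod_eq_one fun i _ => ?_
  rw [← sum_div, ← Nat.cast_sum, sum_letterCount_pairSeq_right]
  exact div_self (by exact_mod_cast (letterCount_pos s i).ne')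

variable [Fintype γ]

theorem card_image_letterCount_le (s : Fin n → γ) :
    (#((univ : Finset (Fin n → α)).image fun t => letterCount (pairSeq s t)) : ℝ) ≤
      polyFactor n (Fintype.card γ * Fintype.card α) := by
  classical
  have hsub : ((univ : Finset (Fin n → α)).image fun t => letterCount (pairSeq s t)) ⊆
      Fintype.piFinset fun _ : γ × α => range (n + 1) := by
    simp only [image_subset_iff, Fintype.mem_piFinset, mem_range_succ_iff]
    exact fun t _ p => letterCount_le _ p
  calc (#((univ : Finset (Fin n → α)).image fun t => letterCount (pairSeq s t)) : ℝ)
      ≤ ((n + 1) ^ (Fintype.card γ * Fintype.card α) : ℕ) := by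
        exact_mod_cast (card_le_card hsub).trans_eq (by simp)
    _ ≤ polyFactor n (Fintype.card γ * Fintype.card α) := by
        push_cast
        exact pow_le_pow_left₀ (by positivity) (by linarith [one_le_polyBase n]) _

-- Bound each likelihood by its sum over all joint types; there are polynomially many of these,
-- and each is the law of a memoryless channel.
theorem sum_condLik_le (s : Fin n → γ) :
    ∑ t : Fin n → α, condLik s t ≤ polyFactor n (Fintype.card γ * Fintype.card α) := by
  classical
  let types := (univ : Finset (Fin n → α)).image fun t => letterCount (pairSeq s t)
  calc ∑ t : Fin n → α, condLik s t
      ≤ ∑ t : Fin n → α, ∑ k ∈ types, ∏ i, (k (s i, t i) : ℝ) / letterCount s (s i) :=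
        sum_le_sum fun t _ => single_le_sum
          (f := fun k : γ × α → ℕ => ∏ i, (k (s i, t i) : ℝ) / letterCount s (s i))
          (fun k _ => prod_nonneg fun i _ => by positivity)
          (mem_image_of_mem (fun t => letterCount (pairSeq s t)) (mem_univ t))
    _ = ∑ k ∈ types, 1 := by
        rw [sum_comm]
        refine sum_congr rfl fun k hk => ?_
        obtain ⟨t, -, rfl⟩ := mem_image.1 hk
        exact sum_prod_letterCount_div_eq_one s t
    _ ≤ polyFactor n (Fintype.card γ * Fintype.card α) := by
        simpa using card_image_letterCount_le s

end Counting

section RandomPermutations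

variable {α γ δ : Type*} {n : ℕ}

theorem pow_self_le_exp_mul_factorial (k : ℕ) : (k : ℝ) ^ k ≤ Real.exp k * k ! := by
  have := Real.pow_div_factorial_le_exp (k : ℝ) (by positivity) k
  rwa [div_le_iff₀ (by positivity)] at this

-- Stirling's sequence `k ! / (√(2k) (k / e) ^ k)` decreases from its value `e / √2` at `k = 1`.
theorem factorial_mul_exp_le (k : ℕ) :
    (k ! : ℝ) * Real.exp k ≤ 3 * (k + 1) * (k : ℝ) ^ k := by
  rcases k with _ | k
  · norm_num
  have hstirling : Stirling.stirlingSeq (k + 1) ≤ Real.exp 1 / √2 :=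
    (Stirling.stirlingSeq'_antitone k.zero_le).trans_eq Stirling.stirlingSeq_one
  set m := k + 1
  have hm : (0 : ℝ) < m := by positivity
  have hsqrt : √(m : ℝ) ≤ m + 1 := Real.sqrt_le_iff.2 ⟨by positivity, by nlinarith⟩
  rw [Stirling.stirlingSeq, div_le_iff₀ (by positivity), Real.sqrt_mul (by norm_num), div_pow,
    ← Real.exp_nat_mul, mul_one] at hstirling
  calc (m ! : ℝ) * Real.exp m
      ≤ Real.exp 1 / √2 * (√2 * √m * (m ^ m / Real.exp m)) * Real.exp m := by gcongr
    _ = Real.exp 1 * √m * m ^ m := by field_simp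
    _ ≤ 3 * (m + 1) * m ^ m := by gcongr; exact Real.exp_one_lt_three.le

theorem condLik_eq_prod_pow_div [Fintype α] [Fintype γ] (s : Fin n → γ) (t : Fin n → α) :
    condLik s t = (∏ p, (letterCount (pairSeq s t) p : ℝ) ^ letterCount (pairSeq s t) p) /
      ∏ c, (letterCount s c : ℝ) ^ letterCount s c := by
  rw [condLik, prod_div_distrib,
    ← prod_comp_eq_prod_pow_letterCount s fun c => (letterCount s c : ℝ),
    ← prod_comp_eq_prod_pow_letterCount (pairSeq s t) fun p => (letterCount (pairSeq s t) p : ℝ)]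
  rfl

theorem prod_exp_letterCount [Fintype α] (s : Fin n → α) :
    ∏ a, Real.exp (letterCount s a) = Real.exp n := by
  rw [← Real.exp_sum, sum_letterCount]

theorem prod_factorial_mul_exp_le [Fintype α] (s : Fin n → α) :
    (∏ a, ((letterCount s a)! : ℝ)) * Real.exp n ≤
      polyFactor n (Fintype.card α) * ∏ a, (letterCount s a : ℝ) ^ letterCount s a := by
  rw [← prod_exp_letterCount s, ← prod_mul_distrib, polyFactor, ← card_univ, ← prod_const,
    ← prod_mul_distrib]
  refine prod_le_prod (fun _ _ => by positivity) fun a _ => ?_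
  refine (factorial_mul_exp_le _).trans ?_
  have : (letterCount s a : ℝ) ≤ n := by exact_mod_cast letterCount_le s a
  gcongr

theorem prod_pow_le_exp_mul_prod_factorial [Fintype α] (s : Fin n → α) :
    ∏ a, (letterCount s a : ℝ) ^ letterCount s a ≤
      Real.exp n * ∏ a, ((letterCount s a)! : ℝ) := by
  rw [← prod_exp_letterCount s, ← prod_mul_distrib]
  exact prod_le_prod (fun _ _ => by positivity) fun a _ => pow_self_le_exp_mul_factorial _

theorem prod_factorial_pairSeq_le [Fintype α] [Fintype γ] (s : Fin n → γ) (t : Fin n → α) :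
    (∏ p, ((letterCount (pairSeq s t) p)! : ℝ)) ≤
      polyFactor n (Fintype.card γ * Fintype.card α) * condLik s t *
        ∏ c, ((letterCount s c)! : ℝ) := by
  have hpos : 0 < ∏ c, (letterCount s c : ℝ) ^ letterCount s c :=
    prod_pos fun c _ => by exact_mod_cast Nat.pow_self_pos
  have hpair := prod_factorial_mul_exp_le (pairSeq s t)
  have hs := prod_pow_le_exp_mul_prod_factorial s
  rw [condLik_eq_prod_pow_div, mul_div_assoc', div_mul_eq_mul_div, le_div_iff₀ hpos,
    ← Fintype.card_prod]
  calc (∏ p, ((letterCount (pairSeq s t) p)! : ℝ)) * ∏ c, (letterCount s c : ℝ) ^ letterCount s c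
      ≤ (∏ p, ((letterCount (pairSeq s t) p)! : ℝ)) *
          (Real.exp n * ∏ c, ((letterCount s c)! : ℝ)) := by gcongr
    _ ≤ _ := by
        rw [← mul_assoc]
        gcongr

/-- The permutations of positions that fix the sequence `s`. -/
def Stab (s : Fin n → γ) : Type := {σ : Equiv.Perm (Fin n) // s ∘ σ = s}

instance (s : Fin n → γ) : Finite (Stab s) :=
  inferInstanceAs (Finite {σ : Equiv.Perm (Fin n) // s ∘ σ = s})

instance (s : Fin n → γ) : Fintype (Stab s) := Fintype.ofFinite _

instance (s : Fin n → γ) : Nonempty (Stab s) := ⟨⟨1, rfl⟩⟩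

theorem card_stab [Fintype γ] (s : Fin n → γ) :
    Fintype.card (Stab s) = ∏ c, (letterCount s c)! := by
  classical
  have h := DomMulAct.stabilizer_card s
  rw [← Nat.card_eq_fintype_card] at h ⊢
  refine h.trans (prod_congr rfl fun c _ => ?_)
  rw [Fintype.card_subtype, letterCount]

theorem card_perm_comp_eq_le [Fintype γ] [DecidableEq γ] (s s' : Fin n → γ) :
    #{σ : Equiv.Perm (Fin n) | s ∘ σ = s'} ≤ ∏ c, (letterCount s c)! := by
  obtain hempty | ⟨τ, hτ⟩ :=
    ({σ : Equiv.Perm (Fin n) | s ∘ σ = s'} : Finset (Equiv.Perm (Fin n))).eq_empty_or_nonempty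
  · simp [hempty]
  have hfix : ∀ σ ∈ ({σ | s ∘ σ = s'} : Finset (Equiv.Perm (Fin n))), s ∘ ⇑(σ * τ⁻¹) = s := by
    intro σ hσ
    have heq : s ∘ σ = s ∘ τ := (mem_filter_univ _).1 hσ |>.trans ((mem_filter_univ _).1 hτ).symm
    funext i
    simpa using congrFun heq (τ⁻¹ i)
  calc #{σ : Equiv.Perm (Fin n) | s ∘ σ = s'}
      = Fintype.card ({σ | s ∘ σ = s'} : Finset (Equiv.Perm (Fin n))) := (Fintype.card_coe _).symm
    _ ≤ Fintype.card (Stab s) :=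
        Fintype.card_le_of_injective (fun σ => (⟨σ * τ⁻¹, hfix σ σ.2⟩ : Stab s)) fun σ σ' h =>
          Subtype.ext (mul_right_cancel (congrArg Subtype.val h))
    _ = ∏ c, (letterCount s c)! := card_stab s

theorem card_stab_comp_eq_le [Fintype α] [Fintype γ] [DecidableEq α] (s : Fin n → γ)
    (t t' : Fin n → α) :
    #{σ : Stab s | t ∘ σ.1 = t'} ≤ ∏ p, (letterCount (pairSeq s t) p)! := by
  classical
  refine le_trans (card_le_card_of_injOn Subtype.val ?_ Subtype.val_injective.injOn)
    (card_perm_comp_eq_le (pairSeq s t) (pairSeq s t'))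
  intro σ hσ
  have hσ' : t ∘ σ.1 = t' := (mem_filter_univ σ).1 hσ
  exact (mem_filter_univ _).2 (funext fun i => Prod.ext (congrFun σ.2 i) (congrFun hσ' i))

-- The law of `t ∘ σ` is uniform on the conditional type class of `t` given `s`, whose size is
-- `1 / condLik s t` up to a polynomial factor.
theorem expect_comp_stab_le [Fintype α] [Fintype γ] (s : Fin n → γ) (t : Fin n → α)
    {F : (Fin n → α) → ℝ} (hF : 0 ≤ F) :
    𝔼 σ : Stab s, F (t ∘ σ.1) ≤
      polyFactor n (Fintype.card γ * Fintype.card α) * condLik s t * ∑ t', F t' := by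
  classical
  have hcard : (0 : ℝ) < Fintype.card (Stab s) := by exact_mod_cast Fintype.card_pos
  have hfiber (t' : Fin n → α) : (#{σ : Stab s | t ∘ σ.1 = t'} : ℝ) ≤
      polyFactor n (Fintype.card γ * Fintype.card α) * condLik s t * Fintype.card (Stab s) := by
    refine le_trans ?_ ((prod_factorial_pairSeq_le s t).trans_eq ?_)
    · exact_mod_cast card_stab_comp_eq_le s t t'
    · rw [card_stab]; push_cast; rfl
  rw [Fintype.expect_eq_sum_div_card, div_le_iff₀ hcard]
  calc ∑ σ : Stab s, F (t ∘ σ.1) = ∑ t', #{σ : Stab s | t ∘ σ.1 = t'} * F t' := by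
        rw [← sum_fiberwise' univ (fun σ : Stab s => t ∘ σ.1)]
        simp
    _ ≤ ∑ t', polyFactor n (Fintype.card γ * Fintype.card α) * condLik s t *
          Fintype.card (Stab s) * F t' :=
        sum_le_sum fun t' _ => mul_le_mul_of_nonneg_right (hfiber t') (hF t')
    _ = _ := by rw [← mul_sum]; ring

-- `f` is the information density `condLik r / condLik s` of the random sequence `t ∘ σ`.
theorem expect_stab_le_of_mul_condLik_eq [Fintype α] [Fintype γ] [Fintype δ] {s : Fin n → γ}
    {t : Fin n → α} (r : Fin n → δ) {f : Stab s → ℝ}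
    (hf : ∀ σ, f σ * condLik s t = condLik r (t ∘ σ.1)) :
    𝔼 σ, f σ ≤
      polyFactor n (Fintype.card γ * Fintype.card α + Fintype.card δ * Fintype.card α) := by
  refine le_of_mul_le_mul_right ?_ (condLik_pos s t)
  calc (𝔼 σ, f σ) * condLik s t = 𝔼 σ : Stab s, condLik r (t ∘ σ.1) := by
        simp only [expect_mul, hf]
    _ ≤ polyFactor n (Fintype.card γ * Fintype.card α) * condLik s t * ∑ t', condLik r t' :=
        expect_comp_stab_le s t fun t' => (condLik_pos r t').le
    _ ≤ polyFactor n (Fintype.card γ * Fintype.card α) * condLik s t *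
          polyFactor n (Fintype.card δ * Fintype.card α) :=
        mul_le_mul_of_nonneg_left (sum_condLik_le r)
          (mul_pos (polyFactor_pos _ _) (condLik_pos s t)).le
    _ = _ := by rw [polyFactor_add]; ring

end RandomPermutations

section EmpiricalInformation

variable {α β γ : Type*} {n : ℕ} [Fintype α] [Fintype β] [Fintype γ]

theorem empInfo_eq_sum (s : Fin n → α) (t : Fin n → β) :
    empInfo s t = ∑ p, seqType (pairSeq s t) p *
      Real.logb 2 (seqType (pairSeq s t) p / (seqType s p.1 * seqType t p.2)) := by
  rw [empInfo, mutualInfo, Fintype.sum_prod_type, fstMarg_seqType_pairSeq, sndMarg_seqType_pairSeq]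

theorem two_rpow_mul_empInfo (s : Fin n → α) (t : Fin n → β) :
    (2 : ℝ) ^ ((n : ℝ) * empInfo s t) = ∏ i, (letterCount (pairSeq s t) (s i, t i) : ℝ) * n /
      (letterCount s (s i) * letterCount t (t i)) := by
  rw [empInfo_eq_sum, mul_sum_seqType_mul (pairSeq s t), Real.rpow_sum_of_pos two_pos]
  refine prod_congr rfl fun i _ => ?_
  have hn : (0 : ℝ) < n := by exact_mod_cast i.pos
  have hs : (0 : ℝ) < letterCount s (s i) := by exact_mod_cast letterCount_pos s i
  have ht : (0 : ℝ) < letterCount t (t i) := by exact_mod_cast letterCount_pos t i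
  have hst : (0 : ℝ) < letterCount (pairSeq s t) (s i, t i) := by
    exact_mod_cast letterCount_pos (pairSeq s t) i
  simp only [seqType_eq_letterCount_div, pairSeq]
  rw [Real.rpow_logb two_pos (by norm_num) (by positivity)]
  field_simp

theorem two_rpow_empInfo_mul_condLik (s : Fin n → α) (t : Fin n → β) :
    (2 : ℝ) ^ ((n : ℝ) * empInfo s t) * condLik (fun _ => ()) s = condLik t s := by
  rw [two_rpow_mul_empInfo, condLik_const, condLik, ← prod_mul_distrib]
  refine prod_congr rfl fun i _ => ?_
  have hs : (letterCount s (s i) : ℝ) ≠ 0 := by exact_mod_cast (letterCount_pos s i).ne'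
  have hn : (n : ℝ) ≠ 0 := by exact_mod_cast i.pos.ne'
  rw [letterCount_pairSeq_swap]
  field_simp

theorem two_rpow_empInfo_sub_mul_condLik (u : Fin n → γ) (x : Fin n → α) (y : Fin n → β) :
    (2 : ℝ) ^ ((n : ℝ) * (empInfo (pairSeq u x) y - empInfo u y)) * condLik u x =
      condLik (pairSeq u y) x := by
  rw [mul_sub, Real.rpow_sub two_pos, two_rpow_mul_empInfo, two_rpow_mul_empInfo,
    condLik, condLik, ← prod_div_distrib, ← prod_mul_distrib]
  refine prod_congr rfl fun i _ => ?_
  have hn : (n : ℝ) ≠ 0 := by exact_mod_cast i.pos.ne'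
  have hu : (letterCount u (u i) : ℝ) ≠ 0 := by exact_mod_cast (letterCount_pos u i).ne'
  have hy : (letterCount y (y i) : ℝ) ≠ 0 := by exact_mod_cast (letterCount_pos y i).ne'
  have hux : (letterCount (pairSeq u x) (pairSeq u x i) : ℝ) ≠ 0 := by
    exact_mod_cast (letterCount_pos (pairSeq u x) i).ne'
  have huy : (letterCount (pairSeq u y) (pairSeq u y i) : ℝ) ≠ 0 := by
    exact_mod_cast (letterCount_pos (pairSeq u y) i).ne'
  have hcomm : letterCount (pairSeq (pairSeq u y) x) (pairSeq u y i, x i) =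
      letterCount (pairSeq (pairSeq u x) y) (pairSeq u x i, y i) :=
    letterCount_pairSeq_right_comm u x y (u i) (x i) (y i)
  rw [hcomm]
  simp only [pairSeq] at hux huy ⊢
  field_simp

theorem empInfo_comp_perm (s : Fin n → α) (t : Fin n → β) (σ : Equiv.Perm (Fin n)) :
    empInfo (s ∘ σ) (t ∘ σ) = empInfo s t := by
  have h : pairSeq (s ∘ σ) (t ∘ σ) = pairSeq s t ∘ σ := rfl
  rw [empInfo, h, seqType_comp_perm, empInfo]

theorem empInfo_comp_perm_left (s : Fin n → α) (t : Fin n → β) (σ : Equiv.Perm (Fin n)) :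
    empInfo (s ∘ σ) t = empInfo s (t ∘ σ.symm) := by
  simpa [Function.comp_assoc] using empInfo_comp_perm s (t ∘ σ.symm) σ

theorem expect_perm_two_rpow_empInfo_le (s : Fin n → α) (t : Fin n → β) :
    𝔼 π : Equiv.Perm (Fin n), (2 : ℝ) ^ ((n : ℝ) * empInfo (s ∘ π) t) ≤
      polyFactor n (Fintype.card α + Fintype.card β * Fintype.card α) := by
  let e : Stab (fun _ : Fin n => ()) ≃ Equiv.Perm (Fin n) := Equiv.subtypeUnivEquiv fun _ => rfl
  rw [← Fintype.expect_equiv e (fun σ => (2 : ℝ) ^ ((n : ℝ) * empInfo (s ∘ σ.1) t)) _ fun _ => rfl]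
  refine (expect_stab_le_of_mul_condLik_eq t (t := s) fun σ => ?_).trans_eq (by simp)
  rw [← two_rpow_empInfo_mul_condLik (s ∘ σ.1)]
  congr 1
  exact (condLik_comp_perm (fun _ => ()) s σ.1).symm

theorem expect_stab_two_rpow_empInfo_sub_le (u : Fin n → γ) (x : Fin n → α) (y : Fin n → β)
    (π : Equiv.Perm (Fin n)) :
    𝔼 σ : Stab u, (2 : ℝ) ^ ((n : ℝ) *
        (empInfo (pairSeq (u ∘ π) ((x ∘ σ.1) ∘ π)) y - empInfo (u ∘ π) y)) ≤
      polyFactor n (Fintype.card γ * Fintype.card α +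
        Fintype.card γ * Fintype.card β * Fintype.card α) := by
  refine (expect_stab_le_of_mul_condLik_eq (pairSeq u (y ∘ π.symm)) (t := x) fun σ => ?_).trans_eq
    (by simp)
  have hperm : pairSeq (u ∘ π) ((x ∘ σ.1) ∘ π) = pairSeq u (x ∘ σ.1) ∘ π := rfl
  have hlik : condLik u (x ∘ σ.1) = condLik u x := by
    simpa only [σ.2] using condLik_comp_perm u x σ.1
  rw [hperm, empInfo_comp_perm_left, empInfo_comp_perm_left, ← hlik,
    two_rpow_empInfo_sub_mul_condLik]

end EmpiricalInformation

section Expectation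

variable {ι κ Ω Ω' : Type*}

theorem expect_prod_le_of_forall_snd [Fintype Ω] [Fintype Ω'] [Nonempty Ω'] {f : Ω × Ω' → ℝ}
    {K : ℝ} (h : ∀ b, 𝔼 a, f (a, b) ≤ K) : 𝔼 p, f p ≤ K := by
  rw [← univ_product_univ, expect_product, expect_comm]
  exact expect_le univ_nonempty fun b _ => h b

theorem expect_prod_le_of_forall_fst [Fintype Ω] [Fintype Ω'] [Nonempty Ω] {f : Ω × Ω' → ℝ}
    {K : ℝ} (h : ∀ a, 𝔼 b, f (a, b) ≤ K) : 𝔼 p, f p ≤ K := by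
  rw [← univ_product_univ, expect_product]
  exact expect_le univ_nonempty fun a _ => h a

theorem expect_sum_mul_sum_two_rpow_le [Fintype κ] [Fintype Ω] {w : Ω → κ → ℝ} {I : ι → Ω → κ → ℝ}
    {s : Finset ι} {t R c K : ℝ} (hs : #s ≤ c * (2 : ℝ) ^ (t * R)) (hK : 0 ≤ K)
    (h : ∀ i ∈ s, 𝔼 ω, ∑ y, w ω y * (2 : ℝ) ^ (t * I i ω y) ≤ K) :
    𝔼 ω, ∑ y, w ω y * ∑ i ∈ s, (2 : ℝ) ^ (t * (I i ω y - R)) ≤ c * K := by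
  have hpos : (0 : ℝ) < 2 ^ (t * R) := by positivity
  calc 𝔼 ω, ∑ y, w ω y * ∑ i ∈ s, (2 : ℝ) ^ (t * (I i ω y - R))
      = ∑ i ∈ s, (𝔼 ω, ∑ y, w ω y * (2 : ℝ) ^ (t * I i ω y)) / 2 ^ (t * R) := by
        simp only [mul_sub, Real.rpow_sub two_pos, mul_sum, ← mul_div_assoc]
        simp only [sum_comm (s := univ) (t := s), expect_sum_comm, ← sum_div, ← expect_div]
    _ ≤ ∑ i ∈ s, K / 2 ^ (t * R) :=
        sum_le_sum fun i hi => div_le_div_of_nonneg_right (h i hi) hpos.le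
    _ ≤ c * K := by
        rw [sum_const, nsmul_eq_mul, mul_div_assoc', div_le_iff₀ hpos]
        nlinarith

variable [Fintype ι] [DecidableEq ι] [Fintype Ω] [Nonempty Ω]

-- Exchanging the `j`-th coordinate with an independent copy is an involution.
theorem expect_expect_update (F : (ι → Ω) → ℝ) (j : ι) :
    𝔼 f, 𝔼 b, F (Function.update f j b) = 𝔼 f, F f := by
  let swap (p : (ι → Ω) × Ω) : (ι → Ω) × Ω := (Function.update p.1 j p.2, p.1 j)
  have hswap : Function.Involutive swap := fun p => by simp [swap]
  calc 𝔼 f, 𝔼 b, F (Function.update f j b) = 𝔼 p : (ι → Ω) × Ω, F (swap p).1 := by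
        rw [← univ_product_univ, expect_product]
    _ = 𝔼 p : (ι → Ω) × Ω, F p.1 :=
        Fintype.expect_equiv hswap.toPerm _ _ fun _ => rfl
    _ = 𝔼 f, F f := by
        rw [← univ_product_univ, expect_product]
        simp only [Fintype.expect_const]

theorem expect_sum_mul_le [Fintype κ] {w g : (ι → Ω) → κ → ℝ} {A B : ℝ} (j : ι) (hB : 0 ≤ B)
    (hw : ∀ f y, 0 ≤ w f y) (hwA : ∀ f, ∑ y, w f y ≤ A)
    (hwj : ∀ f b, w (Function.update f j b) = w f)
    (hg : ∀ f y, 𝔼 b, g (Function.update f j b) y ≤ B) :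
    𝔼 f, ∑ y, w f y * g f y ≤ A * B := by
  rw [← expect_expect_update _ j]
  refine expect_le univ_nonempty fun f _ => ?_
  calc 𝔼 b, ∑ y, w (Function.update f j b) y * g (Function.update f j b) y
      = ∑ y, w f y * 𝔼 b, g (Function.update f j b) y := by
        simp only [hwj, expect_sum_comm, mul_expect]
    _ ≤ ∑ y, w f y * B := sum_le_sum fun y _ => mul_le_mul_of_nonneg_left (hg f y) (hw f y)
    _ ≤ A * B := by
        rw [← sum_mul]
        exact mul_le_mul_of_nonneg_right (hwA f) hB

end Expectation

section MessageAverages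

variable {n : ℕ} {R R₁ R₂ : ℝ}

instance : Nonempty (Msg n R) :=
  Fin.pos_iff_nonempty.1 (Nat.ceil_pos.2 (by positivity))

theorem card_msg_le (hR : 0 ≤ R) : (Fintype.card (Msg n R) : ℝ) ≤ 2 * 2 ^ ((n : ℝ) * R) := by
  have hone : (1 : ℝ) ≤ 2 ^ ((n : ℝ) * R) := Real.one_le_rpow one_le_two (by positivity)
  rw [Fintype.card_fin]
  linarith [Nat.ceil_lt_add_one (zero_le_one.trans hone)]

theorem Code.avg_eq_expect (f : Msg n R₁ → Msg n R₂ → ℝ) :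
    Code.avg f = 𝔼 m : Msg n R₁ × Msg n R₂, f m.1 m.2 := by
  rw [Fintype.expect_eq_sum_div_card, Fintype.sum_prod_type, Fintype.card_prod, Nat.cast_mul,
    Code.avg]

end MessageAverages

section RandomCode

variable {U X Y : Type*} {n : ℕ} {R₁ R₂ : ℝ}

/-- The superposition codebook obtained from the pair of sequences `(u, x)` by permuting the
positions of both by `π m₂`, after permuting those of `x` alone by `σ (m₁, m₂)`, which fixes `u`.
The random code of the achievability proof has independent uniform `π m₂` and `σ (m₁, m₂)`. -/
def permBook (u : Fin n → U) (x : Fin n → X)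
    (ω : (Msg n R₂ → Equiv.Perm (Fin n)) × (Msg n R₁ × Msg n R₂ → Stab u)) :
    Codebook U X n R₁ R₂ where
  u m₂ := u ∘ ω.1 m₂
  x m₁ m₂ := (x ∘ (ω.2 (m₁, m₂)).1) ∘ ω.1 m₂

theorem pairSeq_permBook (u : Fin n → U) (x : Fin n → X)
    (ω : (Msg n R₂ → Equiv.Perm (Fin n)) × (Msg n R₁ × Msg n R₂ → Stab u))
    (m₁ : Msg n R₁) (m₂ : Msg n R₂) :
    pairSeq ((permBook u x ω).u m₂) ((permBook u x ω).x m₁ m₂) =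
      (pairSeq u x ∘ (ω.2 (m₁, m₂)).1) ∘ ω.1 m₂ :=
  funext fun i => Prod.ext (congrFun (ω.2 (m₁, m₂)).2 (ω.1 m₂ i)).symm rfl

theorem seqType_permBook (u : Fin n → U) (x : Fin n → X)
    (ω : (Msg n R₂ → Equiv.Perm (Fin n)) × (Msg n R₁ × Msg n R₂ → Stab u))
    (m₁ : Msg n R₁) (m₂ : Msg n R₂) :
    seqType (pairSeq ((permBook u x ω).u m₂) ((permBook u x ω).x m₁ m₂)) =
      seqType (pairSeq u x) := by
  rw [pairSeq_permBook, seqType_comp_perm, seqType_comp_perm]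

namespace Codebook

/-- The likelihood of `y` under its conditional type given the transmitted pair of sequences. -/
def weight (C : Codebook U X n R₁ R₂) (m₁ : Msg n R₁) (m₂ : Msg n R₂) (y : Fin n → Y) : ℝ :=
  condLik (pairSeq (C.u m₂) (C.x m₁ m₂)) y

theorem weight_pos (C : Codebook U X n R₁ R₂) (m₁ : Msg n R₁) (m₂ : Msg n R₂) (y : Fin n → Y) :
    0 < C.weight m₁ m₂ y := condLik_pos _ _

variable [Fintype U] [Fintype X] [Fintype Y]

/-- The total strength, at the channel output `y`, of the competitors of the transmitted messages
`(m₁, m₂)`: pairs from other clouds, satellites in the same cloud, and other cloud centers. -/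
def score (C : Codebook U X n R₁ R₂) (m₁ : Msg n R₁) (m₂ : Msg n R₂) (y : Fin n → Y) : ℝ :=
  1 + (∑ m : Msg n R₁ × Msg n R₂ with m.2 ≠ m₂, 2 ^ ((n : ℝ) * (C.info₁₂ y m - (R₁ + R₂)))) +
    (∑ m with m ≠ m₁, 2 ^ ((n : ℝ) * (C.info₁₂ y (m, m₂) - C.info₂ y m₂ - R₁))) +
    ∑ m with m ≠ m₂, 2 ^ ((n : ℝ) * (C.info₂ y m - R₂))

variable (Y) in
/-- The score of a codebook for the output alphabet `Y`, averaged over messages and weighted over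
outputs. A codebook with a small mean score is good for every channel and every two-step decoder
at once. -/
def meanScore (C : Codebook U X n R₁ R₂) : ℝ :=
  Code.avg fun m₁ m₂ => ∑ y : Fin n → Y, C.weight m₁ m₂ y * C.score m₁ m₂ y

end Codebook

variable [Fintype U] [Fintype X] [Fintype Y]

/-- A degree that dominates those of all polynomial factors of the random coding argument. -/
def codeDegree (U X Y : Type*) [Fintype U] [Fintype X] [Fintype Y] : ℕ :=
  Fintype.card U * (Fintype.card X + 1) * (Fintype.card Y + 1)

theorem sum_weight_le (C : Codebook U X n R₁ R₂) (m₁ : Msg n R₁) (m₂ : Msg n R₂) :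
    ∑ y : Fin n → Y, C.weight m₁ m₂ y ≤ polyFactor n (codeDegree U X Y) := by
  refine (sum_condLik_le (pairSeq (C.u m₂) (C.x m₁ m₂))).trans (polyFactor_mono n ?_)
  rw [Fintype.card_prod, codeDegree]
  gcongr <;> exact Nat.le_succ _

variable (u : Fin n → U) (x : Fin n → X) {m₁ : Msg n R₁} {m₂ : Msg n R₂}

theorem expect_weight_mul_info₁₂_le {m : Msg n R₁ × Msg n R₂} (hm : m.2 ≠ m₂) :
    𝔼 ω, ∑ y : Fin n → Y, (permBook u x ω).weight m₁ m₂ y *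
        2 ^ ((n : ℝ) * (permBook u x ω).info₁₂ y m) ≤
      polyFactor n (codeDegree U X Y) * polyFactor n (codeDegree U X Y) := by
  refine expect_prod_le_of_forall_snd fun σ => ?_
  refine expect_sum_mul_le m.2 (polyFactor_pos _ _).le (fun π y => (Codebook.weight_pos _ _ _ y).le)
    (fun π => sum_weight_le _ _ _) (fun π b => ?_) fun π y => ?_
  · funext y
    simp only [Codebook.weight, permBook, Function.update_of_ne hm.symm]
  · have h := expect_perm_two_rpow_empInfo_le (pairSeq u x ∘ (σ m).1) y
    simp only [Codebook.info₁₂, pairSeq_permBook, Function.update_self]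
    refine h.trans (polyFactor_mono n ?_)
    rw [Fintype.card_prod, codeDegree]
    nlinarith

theorem expect_weight_mul_info₂_le {m : Msg n R₂} (hm : m ≠ m₂) :
    𝔼 ω, ∑ y : Fin n → Y, (permBook u x ω).weight m₁ m₂ y *
        2 ^ ((n : ℝ) * (permBook u x ω).info₂ y m) ≤
      polyFactor n (codeDegree U X Y) * polyFactor n (codeDegree U X Y) := by
  refine expect_prod_le_of_forall_snd fun σ => ?_
  refine expect_sum_mul_le m (polyFactor_pos _ _).le (fun π y => (Codebook.weight_pos _ _ _ y).le)
    (fun π => sum_weight_le _ _ _) (fun π b => ?_) fun π y => ?_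
  · funext y
    simp only [Codebook.weight, permBook, Function.update_of_ne hm.symm]
  · have h := expect_perm_two_rpow_empInfo_le u y
    simp only [Codebook.info₂, permBook, Function.update_self]
    refine h.trans (polyFactor_mono n ?_)
    calc Fintype.card U + Fintype.card Y * Fintype.card U
        = Fintype.card U * 1 * (Fintype.card Y + 1) := by ring
      _ ≤ codeDegree U X Y := by
        rw [codeDegree]
        gcongr
        exact Nat.le_add_left 1 _

theorem expect_weight_mul_info₁₂_sub_info₂_le {m : Msg n R₁} (hm : m ≠ m₁) :
    𝔼 ω, ∑ y : Fin n → Y, (permBook u x ω).weight m₁ m₂ y *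
        2 ^ ((n : ℝ) * ((permBook u x ω).info₁₂ y (m, m₂) - (permBook u x ω).info₂ y m₂)) ≤
      polyFactor n (codeDegree U X Y) * polyFactor n (codeDegree U X Y) := by
  refine expect_prod_le_of_forall_fst fun π => ?_
  have hne : (m₁, m₂) ≠ (m, m₂) := fun h => hm (congrArg Prod.fst h).symm
  refine expect_sum_mul_le (m, m₂) (polyFactor_pos _ _).le
    (fun σ y => (Codebook.weight_pos _ _ _ y).le) (fun σ => sum_weight_le _ _ _) (fun σ b => ?_)
    fun σ y => ?_
  · funext y
    simp only [Codebook.weight, permBook, Function.update_of_ne hne]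
  · have h := expect_stab_two_rpow_empInfo_sub_le u x y (π m₂)
    simp only [Codebook.info₁₂, Codebook.info₂, permBook, Function.update_self]
    refine h.trans (polyFactor_mono n ?_)
    rw [codeDegree]
    nlinarith

theorem expect_weight_mul_score_le (hR₁ : 0 ≤ R₁) (hR₂ : 0 ≤ R₂) :
    𝔼 ω, ∑ y : Fin n → Y, (permBook u x ω).weight m₁ m₂ y * (permBook u x ω).score m₁ m₂ y ≤
      9 * polyFactor n (2 * codeDegree U X Y) := by
  set A := polyFactor n (codeDegree U X Y)
  have hA : 1 ≤ A := one_le_pow₀ (one_le_polyBase n)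
  have hcard₁ : (#{m : Msg n R₁ | m ≠ m₁} : ℝ) ≤ 2 * 2 ^ ((n : ℝ) * R₁) :=
    le_trans (by exact_mod_cast card_le_univ _) (card_msg_le hR₁)
  have hcard₂ : (#{m : Msg n R₂ | m ≠ m₂} : ℝ) ≤ 2 * 2 ^ ((n : ℝ) * R₂) :=
    le_trans (by exact_mod_cast card_le_univ _) (card_msg_le hR₂)
  have hcard₁₂ : (#{m : Msg n R₁ × Msg n R₂ | m.2 ≠ m₂} : ℝ) ≤
      4 * 2 ^ ((n : ℝ) * (R₁ + R₂)) := by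
    calc (#{m : Msg n R₁ × Msg n R₂ | m.2 ≠ m₂} : ℝ)
        ≤ Fintype.card (Msg n R₁ × Msg n R₂) := by exact_mod_cast card_le_univ _
      _ = Fintype.card (Msg n R₁) * Fintype.card (Msg n R₂) := by
        rw [Fintype.card_prod, Nat.cast_mul]
      _ ≤ (2 * 2 ^ ((n : ℝ) * R₁)) * (2 * 2 ^ ((n : ℝ) * R₂)) := by
        gcongr <;> exact card_msg_le ‹_›
      _ = 4 * 2 ^ ((n : ℝ) * (R₁ + R₂)) := by
        rw [mul_add, Real.rpow_add two_pos]
        ring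
  have hself : 𝔼 ω, ∑ y : Fin n → Y, (permBook u x ω).weight m₁ m₂ y ≤ A :=
    expect_le univ_nonempty fun ω _ => sum_weight_le _ _ _
  have hpair := expect_sum_mul_sum_two_rpow_le hcard₁₂ (by positivity) fun m hm =>
    expect_weight_mul_info₁₂_le (Y := Y) (m₁ := m₁) u x ((mem_filter_univ m).1 hm)
  have hsat := expect_sum_mul_sum_two_rpow_le hcard₁ (by positivity) fun m hm =>
    expect_weight_mul_info₁₂_sub_info₂_le (Y := Y) (m₂ := m₂) u x ((mem_filter_univ m).1 hm)
  have hcloud := expect_sum_mul_sum_two_rpow_le hcard₂ (by positivity) fun m hm =>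
    expect_weight_mul_info₂_le (Y := Y) (m₁ := m₁) u x ((mem_filter_univ m).1 hm)
  simp only [Codebook.score, mul_add, mul_one, sum_add_distrib, expect_add_distrib]
  rw [two_mul, polyFactor_add]
  nlinarith

theorem exists_codebook_meanScore_le (hR₁ : 0 ≤ R₁) (hR₂ : 0 ≤ R₂) :
    ∃ C : Codebook U X n R₁ R₂,
      (∀ m₁ m₂, seqType (pairSeq (C.u m₂) (C.x m₁ m₂)) = seqType (pairSeq u x)) ∧
      C.meanScore Y ≤ 9 * polyFactor n (2 * codeDegree U X Y) := by
  have hmean : 𝔼 ω, (permBook u x ω : Codebook U X n R₁ R₂).meanScore Y ≤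
      9 * polyFactor n (2 * codeDegree U X Y) := by
    simp only [Codebook.meanScore, Code.avg_eq_expect]
    rw [expect_comm]
    exact expect_le univ_nonempty fun m _ => expect_weight_mul_score_le u x hR₁ hR₂
  obtain ⟨ω, -, hω⟩ := exists_le_of_expect_le univ_nonempty hmean
  exact ⟨permBook u x ω, seqType_permBook u x ω, hω⟩

end RandomCode

section TypeApproximation

variable {α : Type*} [Fintype α]

theorem exists_seq_letterCount_eq {n : ℕ} (k : α → ℕ) (hk : ∑ a, k a = n) :
    ∃ s : Fin n → α, ∀ a, letterCount s a = k a := by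
  have hcard : Fintype.card (Fin n) = Fintype.card (Σ a, Fin (k a)) := by simp [hk]
  let e := Fintype.equivOfCardEq hcard
  refine ⟨fun i => (e i).1, fun a => ?_⟩
  classical
  calc letterCount (fun i => (e i).1) a = Fintype.card {i // (e i).1 = a} := by
        rw [Fintype.card_subtype, letterCount]
    _ = Fintype.card {p : Σ a, Fin (k a) // p.1 = a} :=
        Fintype.card_congr (e.subtypeEquiv fun _ => Iff.rfl)
    _ = k a := by rw [Fintype.card_congr (Equiv.sigmaSubtype a), Fintype.card_fin]

theorem sum_natFloor_mul_le (P : stdSimplex ℝ α) (n : ℕ) : ∑ a, ⌊P a * (n : ℝ)⌋₊ ≤ n := by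
  have h : ∑ a, (⌊P a * (n : ℝ)⌋₊ : ℝ) ≤ n := by
    calc ∑ a, (⌊P a * (n : ℝ)⌋₊ : ℝ) ≤ ∑ a, P a * (n : ℝ) :=
          sum_le_sum fun a _ => Nat.floor_le (mul_nonneg (P.2.1 a) n.cast_nonneg)
      _ = n := by rw [← sum_mul, show ∑ a, P a = 1 from P.2.2, one_mul]
  exact_mod_cast h

theorem nonempty_of_stdSimplex (P : stdSimplex ℝ α) : Nonempty α :=
  univ_nonempty_iff.1 <| nonempty_of_sum_ne_zero <| P.2.2.trans_ne one_ne_zero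

theorem exists_seqType_tendsto (P : stdSimplex ℝ α) :
    ∃ s : ∀ n : ℕ, Fin n → α, Tendsto (fun n => seqType (s n)) atTop (𝓝 (P : α → ℝ)) := by
  classical
  obtain ⟨a₀⟩ := nonempty_of_stdSimplex P
  let k (n : ℕ) (a : α) : ℕ := ⌊P a * (n : ℝ)⌋₊
  let rest (n : ℕ) : ℕ := n - ∑ a, k n a
  have htotal : ∀ n, ∑ a, (k n + Pi.single a₀ (rest n) : α → ℕ) a = n := fun n => by
    simp only [Pi.add_apply, sum_add_distrib, sum_pi_single', mem_univ, if_true, rest]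
    exact Nat.add_sub_of_le (sum_natFloor_mul_le P n)
  choose s hs using fun n => exists_seq_letterCount_eq _ (htotal n)
  have hk : ∀ a, Tendsto (fun n => (k n a : ℝ) / n) atTop (𝓝 (P a)) := fun a =>
    (tendsto_nat_floor_mul_div_atTop (P.2.1 a)).comp tendsto_natCast_atTop_atTop
  have hrest : Tendsto (fun n => (rest n : ℝ) / n) atTop (𝓝 0) := by
    have h := tendsto_const_nhds (x := (1 : ℝ)).sub (tendsto_finsetSum univ fun a _ => hk a)
    rw [show ∑ a, P a = 1 from P.2.2, sub_self] at h
    refine h.congr' ?_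
    filter_upwards [eventually_ne_atTop 0] with n hn
    simp only [rest]
    rw [Nat.cast_sub (sum_natFloor_mul_le P n), sub_div, div_self (Nat.cast_ne_zero.2 hn),
      Nat.cast_sum, sum_div]
  refine ⟨s, tendsto_pi_nhds.2 fun a => ?_⟩
  have hsingle : Tendsto (fun n => (k n a : ℝ) / n + if a = a₀ then (rest n : ℝ) / n else 0) atTop
      (𝓝 (P a)) := by
    split_ifs
    · simpa using (hk a).add hrest
    · simpa using hk a
  refine hsingle.congr fun n => ?_
  rw [seqType_eq_letterCount_div, hs, Pi.add_apply, Pi.single_apply]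
  split_ifs <;> simp [add_div]

end TypeApproximation

section RelativeEntropy

variable {ι : Type*} [Fintype ι]

theorem sum_mul_logb_sum_div_sum_le {p q : ι → ℝ} (hp : ∀ i, 0 ≤ p i) (hq : ∀ i, 0 ≤ q i)
    (hpq : ∀ i, q i = 0 → p i = 0) :
    (∑ i, p i) * Real.logb 2 ((∑ i, p i) / ∑ i, q i) ≤ ∑ i, p i * Real.logb 2 (p i / q i) := by
  rcases (sum_nonneg fun i _ => hq i : 0 ≤ ∑ i, q i).eq_or_lt with hB | hB
  · have hp0 : ∀ i, p i = 0 := fun i =>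
      hpq i ((sum_eq_zero_iff_of_nonneg fun i _ => hq i).1 hB.symm i (mem_univ i))
    simp [hp0]
  have hcancel : ∀ i, q i / (∑ j, q j) * (p i / q i) = p i / ∑ j, q j := fun i => by
    rw [div_mul_eq_mul_div, mul_div_cancel_of_imp' (hpq i)]
  have hjensen := Real.convexOn_mul_log.map_sum_le (t := univ) (w := fun i => q i / ∑ j, q j)
    (p := fun i => p i / q i) (fun i _ => div_nonneg (hq i) hB.le)
    (by rw [← sum_div, div_self hB.ne']) fun i _ => div_nonneg (hp i) (hq i)
  simp only [smul_eq_mul, ← mul_assoc, hcancel] at hjensen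
  simp only [div_mul_eq_mul_div, ← sum_div] at hjensen
  rw [div_le_div_iff_of_pos_right hB] at hjensen
  simp only [Real.logb, ← mul_div_assoc, ← sum_div]
  gcongr

open Classical in
/-- The relative entropy `D(p ‖ q)` in bits, which is `⊤` unless `p ≪ q`. Conditional divergences
are relative entropies of joint laws, for which data processing takes its simplest form. -/
def relEntropy (p q : ι → ℝ) : EReal :=
  if ∀ i, q i = 0 → p i = 0 then ((∑ i, p i * Real.logb 2 (p i / q i) : ℝ) : EReal) else ⊤

theorem condKL_eq_relEntropy {α β : Type*} [Fintype α] [Fintype β] (V W : α → β → ℝ)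
    (P : α → ℝ) : condKL V W P = relEntropy (joint P V) (joint P W) := by
  have hac : (∀ p, joint P W p = 0 → joint P V p = 0) ↔
      ∀ a b, P a ≠ 0 → W a b = 0 → V a b = 0 := by
    simp only [joint, Prod.forall, mul_eq_zero]
    exact forall₂_congr fun a b => by tauto
  have hterm : ∀ a b, joint P V (a, b) * Real.logb 2 (joint P V (a, b) / joint P W (a, b)) =
      P a * (V a b * Real.logb 2 (V a b / W a b)) := fun a b => by
    rcases eq_or_ne (P a) 0 with h | h
    · simp [joint, h]
    · simp only [joint, mul_div_mul_left _ _ h, mul_assoc]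
  simp only [condKL, relEntropy, hac, Fintype.sum_prod_type, hterm, mul_sum]

end RelativeEntropy

section MutualInformation

variable {α β : Type*} [Fintype α] [Fintype β]

theorem mutualInfo_eq_negMulLog {Q : α × β → ℝ} (hQ : ∀ p, 0 ≤ Q p) :
    mutualInfo Q = (∑ a, Real.negMulLog (fstMarg Q a) + ∑ b, Real.negMulLog (sndMarg Q b) -
      ∑ p, Real.negMulLog (Q p)) / Real.log 2 := by
  have hfst : ∀ a b, Q (a, b) ≤ fstMarg Q a := fun a b =>
    single_le_sum (f := fun b => Q (a, b)) (fun _ _ => hQ _) (mem_univ b)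
  have hsnd : ∀ a b, Q (a, b) ≤ sndMarg Q b := fun a b =>
    single_le_sum (f := fun a => Q (a, b)) (fun _ _ => hQ _) (mem_univ a)
  have hterm : ∀ a b, Q (a, b) * Real.log (Q (a, b) / (fstMarg Q a * sndMarg Q b)) =
      Q (a, b) * Real.log (Q (a, b)) - Q (a, b) * Real.log (fstMarg Q a) -
        Q (a, b) * Real.log (sndMarg Q b) := fun a b => by
    rcases (hQ (a, b)).eq_or_lt with h | h
    · simp [← h]
    · have hf := h.trans_le (hfst a b)
      have hs := h.trans_le (hsnd a b)
      rw [Real.log_div h.ne' (mul_pos hf hs).ne', Real.log_mul hf.ne' hs.ne']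
      ring
  simp only [mutualInfo, Real.logb, ← mul_div_assoc, ← sum_div, hterm]
  congr 1
  simp only [sum_sub_distrib, Real.negMulLog, neg_mul, sum_neg_distrib, Fintype.sum_prod_type]
  rw [sum_comm (f := fun a b => Q (a, b) * Real.log (sndMarg Q b))]
  simp only [← sum_mul, fstMarg, sndMarg]
  ring

theorem continuousOn_mutualInfo :
    ContinuousOn (mutualInfo : (α × β → ℝ) → ℝ) (Set.Ici 0) := by
  have hcont : Continuous fun Q : α × β → ℝ => (∑ a, Real.negMulLog (fstMarg Q a) +
      ∑ b, Real.negMulLog (sndMarg Q b) - ∑ p, Real.negMulLog (Q p)) / Real.log 2 := by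
    unfold fstMarg sndMarg
    have := Real.continuous_negMulLog
    fun_prop
  exact hcont.continuousOn.congr fun Q hQ => mutualInfo_eq_negMulLog hQ

end MutualInformation

section Exponents

variable {α β : Type*} [Fintype α] [Fintype β]

/-- The exponent `min_V [D(V ‖ W | P) + Φ(P × V)]`, for a penalty `Φ` depending on the joint law.
All exponents of the theorem are of this form. -/
def jointExponent (W : α → β → ℝ) (Φ : (α × β → ℝ) → ℝ) (P : α → ℝ) : EReal :=
  ⨅ V : α → stdSimplex ℝ β, condKL (fun a => V a) W P + (Φ (joint P fun a => V a) : ℝ)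

theorem jointExponent_add_le (W : α → β → ℝ) (Φ : (α × β → ℝ) → ℝ) (c : ℝ) (P : α → ℝ) :
    jointExponent W Φ P + c ≤ jointExponent W (fun Q => Φ Q + c) P :=
  le_iInf fun V => by
    rw [EReal.coe_add, ← add_assoc]
    exact add_le_add_left (iInf_le _ V) _

theorem lowerSemicontinuous_condKL (W : α → β → ℝ) :
    LowerSemicontinuous fun p : (α → ℝ) × (α → β → ℝ) => condKL p.2 W p.1 := by
  have hcont : Continuous fun p : (α → ℝ) × (α → β → ℝ) =>
      ∑ a, p.1 a * ∑ b, p.2 a b * Real.logb 2 (p.2 a b / W a b) := by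
    have hlog : ∀ w : ℝ, Continuous fun v : ℝ => v * Real.logb 2 (v / w) := fun w => by
      rcases eq_or_ne w 0 with rfl | hw
      · simpa using continuous_const
      · have h := (Real.continuous_mul_log.comp (continuous_id.div_const w)).const_mul
          (w / Real.log 2)
        refine h.congr fun v => ?_
        simp only [Function.comp_apply, id_eq, Real.logb]
        field_simp
    have hentry : ∀ a b, Continuous fun p : (α → ℝ) × (α → β → ℝ) =>
        p.2 a b * Real.logb 2 (p.2 a b / W a b) := fun a b =>
      (hlog (W a b)).comp (by fun_prop)
    fun_prop
  intro p E hE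
  by_cases hac : ∀ a b, p.1 a ≠ 0 → W a b = 0 → p.2 a b = 0
  · change E < condKL p.2 W p.1 at hE
    rw [condKL, if_pos hac] at hE
    filter_upwards [(continuous_coe_real_ereal.comp hcont).continuousAt.eventually
      (lt_mem_nhds hE)] with q hq
    unfold condKL
    split_ifs
    · exact hq
    · exact hq.trans (EReal.coe_lt_top _)
  · push Not at hac
    obtain ⟨a, b, hPa, hWab, hVab⟩ := hac
    have hopen : ∀ᶠ q : (α → ℝ) × (α → β → ℝ) in 𝓝 p, q.1 a ≠ 0 ∧ q.2 a b ≠ 0 :=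
      ((by fun_prop : ContinuousAt (fun q : (α → ℝ) × (α → β → ℝ) => q.1 a) p).eventually_ne
        hPa).and ((by fun_prop : ContinuousAt (fun q : (α → ℝ) × (α → β → ℝ) => q.2 a b)
          p).eventually_ne hVab)
    filter_upwards [hopen] with q hq
    rw [condKL, if_neg fun h => hq.2 (h a b hq.1 hWab)]
    exact hE.trans_le le_top

theorem lowerSemicontinuousOn_iInf_of_compactSpace {S K γ : Type*} [TopologicalSpace S]
    [TopologicalSpace K] [CompactSpace K] [CompleteLinearOrder γ] [DenselyOrdered γ]
    {g : S × K → γ} {s : Set S} (hg : LowerSemicontinuousOn g (s ×ˢ Set.univ)) :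
    LowerSemicontinuousOn (fun x => ⨅ k, g (x, k)) s := by
  intro x hx E hE
  obtain ⟨F, hEF, hF⟩ := exists_between hE
  have hnear : ∀ᶠ x' in 𝓝 x, ∀ k ∈ (Set.univ : Set K), x' ∈ s → F < g (x', k) := by
    refine isCompact_univ.eventually_forall_of_forall_eventually fun k _ => ?_
    have h := eventually_nhdsWithin_iff.1
      (hg (x, k) ⟨hx, Set.mem_univ k⟩ F (hF.trans_le (iInf_le _ k)))
    exact h.mono fun z hz hzs => hz ⟨hzs, Set.mem_univ _⟩
  refine eventually_nhdsWithin_iff.2 (hnear.mono fun x' h hx' => ?_)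
  exact hEF.trans_le (le_iInf fun k => (h k (Set.mem_univ k) hx').le)

omit [Fintype α] in
theorem joint_nonneg {P : α → ℝ} (hP : 0 ≤ P) (V : α → stdSimplex ℝ β) :
    0 ≤ joint P fun a => V a :=
  fun p => mul_nonneg (hP p.1) ((V p.1).2.1 p.2)

theorem lowerSemicontinuousOn_jointExponent (W : α → β → ℝ) {Φ : (α × β → ℝ) → ℝ}
    (hΦ : ContinuousOn Φ (Set.Ici 0)) :
    LowerSemicontinuousOn (jointExponent W Φ) (Set.Ici 0) := by
  have hV : Continuous fun q : (α → ℝ) × (α → stdSimplex ℝ β) => fun a => (q.2 a : β → ℝ) :=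
    continuous_pi fun a => continuous_subtype_val.comp ((continuous_apply a).comp continuous_snd)
  have hdiv : LowerSemicontinuous fun q : (α → ℝ) × (α → stdSimplex ℝ β) =>
      condKL (fun a => q.2 a) W q.1 :=
    (lowerSemicontinuous_condKL W).comp (continuous_fst.prodMk hV)
  have hjoint : Continuous fun q : (α → ℝ) × (α → stdSimplex ℝ β) =>
      joint q.1 fun a => q.2 a :=
    continuous_pi fun p => ((continuous_apply p.1).comp continuous_fst).mul
      ((continuous_apply p.2).comp ((continuous_apply p.1).comp hV))
  have hpen : ContinuousOn (fun q : (α → ℝ) × (α → stdSimplex ℝ β) =>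
      ((Φ (joint q.1 fun a => q.2 a) : ℝ) : EReal)) (Set.Ici 0 ×ˢ Set.univ) :=
    continuous_coe_real_ereal.comp_continuousOn
      (hΦ.comp hjoint.continuousOn fun q hq => joint_nonneg hq.1 q.2)
  exact lowerSemicontinuousOn_iInf_of_compactSpace <|
    (hdiv.lowerSemicontinuousOn _).add' hpen.lowerSemicontinuousOn fun q _ =>
      EReal.continuousAt_add (Or.inr (EReal.coe_ne_bot _)) (Or.inr (EReal.coe_ne_top _))

omit [Fintype α] in
theorem exists_joint_fstMarg_eq [Nonempty β] {Q : α × β → ℝ} (hQ : 0 ≤ Q) :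
    ∃ V : α → stdSimplex ℝ β, (joint (fstMarg Q) fun a => V a) = Q := by
  have hrow : ∀ a, ∃ v : stdSimplex ℝ β, ∀ b, fstMarg Q a * v b = Q (a, b) := fun a => by
    rcases eq_or_ne (fstMarg Q a) 0 with h | h
    · refine ⟨Classical.arbitrary _, fun b => ?_⟩
      rw [h, zero_mul]
      exact ((sum_eq_zero_iff_of_nonneg fun b _ => hQ (a, b)).1 h b (mem_univ b)).symm
    · refine ⟨⟨fun b => Q (a, b) / fstMarg Q a,
        fun b => div_nonneg (hQ _) (sum_nonneg fun b _ => hQ _), ?_⟩, fun b => ?_⟩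
      · rw [← sum_div]
        exact div_self h
      · exact mul_div_cancel₀ _ h
  choose V hV using hrow
  exact ⟨V, funext fun p => hV p.1 p.2⟩

end Exponents

section DataProcessing

variable {U X Y : Type*} [Fintype U] [Fintype X] [Fintype Y]

/-- The `(U, Y)`-marginal of a law of `(U, X, Y)`. -/
def margUY (Q : (U × X) × Y → ℝ) : U × Y → ℝ := fun p => ∑ x, Q ((p.1, x), p.2)

omit [Fintype U] [Fintype Y] in
theorem margUY_nonneg {Q : (U × X) × Y → ℝ} (hQ : 0 ≤ Q) : 0 ≤ margUY Q :=
  fun _ => sum_nonneg fun _ _ => hQ _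

theorem relEntropy_margUY_le {Q Q' : (U × X) × Y → ℝ} (hQ : 0 ≤ Q) (hQ' : 0 ≤ Q') :
    relEntropy (margUY Q) (margUY Q') ≤ relEntropy Q Q' := by
  by_cases hac : ∀ p, Q' p = 0 → Q p = 0
  · have hac' : ∀ p, margUY Q' p = 0 → margUY Q p = 0 := fun p hp =>
      sum_eq_zero fun x hx => hac _
        ((sum_eq_zero_iff_of_nonneg fun x _ => hQ' ((p.1, x), p.2)).1 hp x hx)
    rw [relEntropy, relEntropy, if_pos hac, if_pos hac', EReal.coe_le_coe_iff]
    calc ∑ p, margUY Q p * Real.logb 2 (margUY Q p / margUY Q' p)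
        ≤ ∑ p : U × Y, ∑ x, Q ((p.1, x), p.2) *
            Real.logb 2 (Q ((p.1, x), p.2) / Q' ((p.1, x), p.2)) :=
          sum_le_sum fun p _ => sum_mul_logb_sum_div_sum_le (fun x => hQ _) (fun x => hQ' _)
            fun x => hac _
      _ = ∑ p, Q p * Real.logb 2 (Q p / Q' p) := by
          simp only [Fintype.sum_prod_type]
          exact sum_congr rfl fun u _ => sum_comm
  · rw [relEntropy, relEntropy, if_neg hac]
    exact le_top

omit [Fintype U] in
theorem fstMarg_margUY_joint (P : U × X → ℝ) (V : U × X → stdSimplex ℝ Y) :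
    fstMarg (margUY (joint P fun p => V p)) = fstMarg P := by
  funext u
  simp only [fstMarg, margUY, joint]
  rw [sum_comm]
  exact sum_congr rfl fun x _ => by
    rw [← mul_sum, show ∑ y, V (u, x) y = 1 from (V (u, x)).2.2, mul_one]

omit [Fintype U] [Fintype Y] in
theorem margUY_joint_chanUX {P : U × X → ℝ} (hP : 0 ≤ P) (WY : X → Y → ℝ) :
    margUY (joint P (chanUX WY)) = joint (fstMarg P) (chanU P WY) := by
  funext ⟨u, y⟩
  simp only [margUY, joint, chanUX, chanU, mul_sum]
  refine sum_congr rfl fun x _ => ?_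
  rcases eq_or_ne (fstMarg P u) 0 with h | h
  · rw [h, zero_mul, (sum_eq_zero_iff_of_nonneg fun x _ => hP (u, x)).1 h x (mem_univ x), zero_mul]
  · field_simp

theorem jointExponent_chanU_le [Nonempty Y] {P : U × X → ℝ} (hP : 0 ≤ P) {WY : X → Y → ℝ}
    (hW : ∀ x y, 0 ≤ WY x y) (Ψ : (U × Y → ℝ) → ℝ) :
    jointExponent (chanU P WY) Ψ (fstMarg P) ≤
      jointExponent (chanUX WY) (fun Q => Ψ (margUY Q)) P := by
  refine le_iInf fun V => ?_
  have hQ := joint_nonneg hP V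
  obtain ⟨V', hV'⟩ := exists_joint_fstMarg_eq (margUY_nonneg hQ)
  rw [fstMarg_margUY_joint] at hV'
  refine (iInf_le _ V').trans ?_
  rw [hV', condKL_eq_relEntropy, condKL_eq_relEntropy, hV', ← margUY_joint_chanUX hP]
  exact add_le_add_left
    (relEntropy_margUY_le hQ fun p => mul_nonneg (hP p.1) (hW p.1.2 p.2)) _

end DataProcessing

section ChannelLikelihood

variable {α β : Type*} [Fintype α] [Fintype β] {n : ℕ}

omit [Fintype α] [Fintype β] in
theorem condLik_eq_prod {V : α → β → ℝ} {s : Fin n → α} {y : Fin n → β}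
    (hV : joint (seqType s) V = seqType (pairSeq s y)) : condLik s y = ∏ i, V (s i) (y i) := by
  refine prod_congr rfl fun i _ => ?_
  have hn : (n : ℝ) ≠ 0 := Nat.cast_ne_zero.2 (Fin.pos i).ne'
  have hs : (letterCount s (s i) : ℝ) ≠ 0 := by exact_mod_cast (letterCount_pos s i).ne'
  have h := congrFun hV (s i, y i)
  simp only [joint, seqType_eq_letterCount_div] at h
  field_simp at h ⊢
  exact h.symm

theorem condKL_seqType {V W : α → β → ℝ} {s : Fin n → α} {y : Fin n → β}
    (hV : joint (seqType s) V = seqType (pairSeq s y)) (hW : ∀ i, 0 < W (s i) (y i)) :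
    ∃ D : ℝ, condKL V W (seqType s) = D ∧
      ∏ i, W (s i) (y i) = condLik s y * 2 ^ (-((n : ℝ) * D)) := by
  have hjoint : ∀ i, seqType (pairSeq s y) (s i, y i) = seqType s (s i) * V (s i) (y i) :=
    fun i => (congrFun hV (s i, y i)).symm
  have hpos : ∀ i, 0 < seqType s (s i) * V (s i) (y i) := fun i => by
    rw [← hjoint, seqType_eq_letterCount_div]
    exact div_pos (Nat.cast_pos.2 (letterCount_pos (pairSeq s y) i)) (Nat.cast_pos.2 (Fin.pos i))
  have hVpos : ∀ i, 0 < V (s i) (y i) := fun i =>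
    pos_of_mul_pos_right (hpos i) (seqType_nonneg s _)
  have hac : ∀ p, joint (seqType s) W p = 0 → seqType (pairSeq s y) p = 0 := fun p hp => by
    rcases eq_or_ne (letterCount (pairSeq s y) p) 0 with h | h
    · rw [seqType_eq_letterCount_div, h, Nat.cast_zero, zero_div]
    · obtain ⟨i, rfl⟩ := letterCount_ne_zero_iff.1 h
      exact absurd hp (mul_ne_zero (left_ne_zero_of_mul (hpos i).ne') (hW i).ne')
  refine ⟨_, by rw [condKL_eq_relEntropy, hV, relEntropy, if_pos hac], ?_⟩
  rw [mul_sum_seqType_mul (pairSeq s y) fun p =>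
    Real.logb 2 (seqType (pairSeq s y) p / joint (seqType s) W p), condLik_eq_prod hV,
    ← sum_neg_distrib, Real.rpow_sum_of_pos two_pos, ← prod_mul_distrib]
  refine prod_congr rfl fun i _ => ?_
  rw [pairSeq, hjoint, joint, mul_div_mul_left _ _ (left_ne_zero_of_mul (hpos i).ne'),
    Real.rpow_neg zero_le_two, Real.rpow_logb two_pos (by norm_num) (div_pos (hVpos i) (hW i)),
    inv_div, mul_div_cancel₀ _ (hVpos i).ne']

theorem prod_le_condLik_mul [Nonempty β] {W : α → β → ℝ} (hW : ∀ a b, 0 ≤ W a b)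
    {Φ : (α × β → ℝ) → ℝ} {s : Fin n → α} {E : ℝ} (hE : E ≤ jointExponent W Φ (seqType s))
    (y : Fin n → β) :
    ∏ i, W (s i) (y i) ≤
      condLik s y * 2 ^ ((n : ℝ) * (Φ (seqType (pairSeq s y)) - E)) := by
  obtain ⟨V, hV⟩ := exists_joint_fstMarg_eq (seqType_nonneg (pairSeq s y))
  rw [fstMarg_seqType_pairSeq] at hV
  by_cases hpos : ∀ i, 0 < W (s i) (y i)
  · obtain ⟨D, hD, hprod⟩ := condKL_seqType hV hpos
    have hED := hE.trans (iInf_le _ V)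
    rw [hV, hD, ← EReal.coe_add, EReal.coe_le_coe_iff] at hED
    rw [hprod]
    gcongr
    · exact (condLik_pos s y).le
    · exact one_le_two
    · nlinarith [n.cast_nonneg (α := ℝ)]
  · push Not at hpos
    obtain ⟨i, hi⟩ := hpos
    rw [prod_eq_zero (mem_univ i) (le_antisymm hi (hW _ _))]
    exact mul_nonneg (condLik_pos s y).le (by positivity)

end ChannelLikelihood

section Penalties

variable {U X Y α β : Type*} [Fintype X]

theorem margUY_seqType {n : ℕ} (u : Fin n → U) (x : Fin n → X) (y : Fin n → Y) :
    margUY (seqType (pairSeq (pairSeq u x) y)) = seqType (pairSeq u y) := by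
  rw [← fstMarg_seqType_pairSeq (pairSeq u y) x]
  funext p
  refine sum_congr rfl fun a _ => ?_
  rw [seqType_eq_letterCount_div, seqType_eq_letterCount_div, letterCount_pairSeq_right_comm]

variable [Fintype α] [Fintype β]

theorem continuousOn_J₂ (R : ℝ) : ContinuousOn (fun Q : α × β → ℝ => J₂ Q R) (Set.Ici 0) :=
  (continuousOn_mutualInfo.sub continuousOn_const).sup continuousOn_const

theorem continuousOn_J₂_margUY [Fintype U] [Fintype Y] (R : ℝ) :
    ContinuousOn (fun Q : (U × X) × Y → ℝ => J₂ (margUY Q) R) (Set.Ici 0) := by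
  have hcont : Continuous (margUY : ((U × X) × Y → ℝ) → U × Y → ℝ) :=
    continuous_pi fun p => continuous_finsetSum univ fun x _ => continuous_apply _
  exact (continuousOn_J₂ R).comp hcont.continuousOn fun _ hQ => margUY_nonneg hQ

end Penalties

section Rates

variable {n : ℕ} {E : EReal} {p q : ℕ → ℝ}

theorem coe_le_expo_iff {x a : ℝ} (hn : 0 < n) (hx : 0 ≤ x) :
    (a : EReal) ≤ expo n x ↔ x ≤ 2 ^ (-((n : ℝ) * a)) := by
  rcases hx.eq_or_lt with rfl | hx
  · simp only [expo, if_true, le_top, true_iff]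
    positivity
  · have hn' : (0 : ℝ) < n := Nat.cast_pos.2 hn
    rw [expo, if_neg hx.ne', EReal.coe_le_coe_iff, one_div x, Real.logb_inv, one_div,
      ← Real.logb_le_iff_le_rpow one_lt_two hx, le_inv_mul_iff₀ hn', le_neg]

theorem expo_anti {x z : ℝ} (hx : 0 ≤ x) (hxz : x ≤ z) : expo n z ≤ expo n x := by
  rcases hx.eq_or_lt with rfl | hx
  · simp only [expo, if_true, le_top]
  · rw [expo, expo, if_neg hx.ne', if_neg (hx.trans_le hxz).ne', EReal.coe_le_coe_iff]
    gcongr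
    · exact one_lt_two
    · exact one_div_pos.2 (hx.trans_le hxz)

theorem eventually_mul_polyFactor_le (c : ℝ) (d : ℕ) {δ : ℝ} (hδ : 0 < δ) :
    ∀ᶠ n : ℕ in atTop, c * polyFactor n d ≤ 2 ^ ((n : ℝ) * δ) := by
  have hlim := ((tendsto_pow_const_div_const_pow_of_one_lt d
    (Real.one_lt_rpow one_lt_two hδ)).const_mul (|c| * 6 ^ d)).eventually_le_const
      (u := 1) (by rw [mul_zero]; exact one_pos)
  filter_upwards [hlim, eventually_ge_atTop 1] with n hn hn1
  have hpoly : polyFactor n d ≤ 6 ^ d * (n : ℝ) ^ d := by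
    have : (1 : ℝ) ≤ n := by exact_mod_cast hn1
    rw [polyFactor, ← mul_pow]
    exact pow_le_pow_left₀ (by positivity) (by linarith) d
  rw [mul_comm (n : ℝ), Real.rpow_mul zero_le_two, Real.rpow_natCast]
  rw [← mul_div_assoc, div_le_one (by positivity)] at hn
  calc c * polyFactor n d ≤ |c| * (6 ^ d * (n : ℝ) ^ d) :=
        mul_le_mul (le_abs_self c) hpoly (polyFactor_pos n d).le (abs_nonneg c)
    _ ≤ _ := by rwa [← mul_assoc]

theorem eventually_le_of_lt_liminf_expo (hp : ∀ n, 0 ≤ p n) {a : ℝ}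
    (ha : a < liminf (fun n => expo n (p n)) atTop) :
    ∀ᶠ n : ℕ in atTop, p n ≤ 2 ^ (-((n : ℝ) * a)) := by
  filter_upwards [eventually_lt_of_lt_liminf ha, eventually_gt_atTop 0] with n hn hpos
  exact (coe_le_expo_iff hpos (hp n)).1 hn.le

theorem le_liminf_expo (hp : ∀ n, 0 ≤ p n) (c : ℝ) (d : ℕ)
    (h : ∀ a : ℝ, a < E → ∀ᶠ n : ℕ in atTop, p n ≤ c * polyFactor n d * 2 ^ (-((n : ℝ) * a))) :
    E ≤ liminf (fun n => expo n (p n)) atTop := by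
  refine EReal.ge_of_forall_gt_iff_ge.1 fun a ha => ?_
  obtain ⟨b, hab, hbE⟩ := EReal.lt_iff_exists_real_btwn.1 ha
  have hab' : 0 < b - a := sub_pos.2 (EReal.coe_lt_coe_iff.1 hab)
  refine le_liminf_of_le (by isBoundedDefault) ?_
  filter_upwards [h b hbE, eventually_mul_polyFactor_le c d hab', eventually_gt_atTop 0]
    with n hn hpoly hpos
  refine (coe_le_expo_iff hpos (hp n)).2 (hn.trans ?_)
  calc c * polyFactor n d * 2 ^ (-((n : ℝ) * b))
      ≤ 2 ^ ((n : ℝ) * (b - a)) * 2 ^ (-((n : ℝ) * b)) := by gcongr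
    _ = 2 ^ (-((n : ℝ) * a)) := by
      rw [← Real.rpow_add two_pos]
      ring_nf

theorem min_liminf_expo_le_liminf_expo_add (hp : ∀ n, 0 ≤ p n) (hq : ∀ n, 0 ≤ q n) :
    min (liminf (fun n => expo n (p n)) atTop) (liminf (fun n => expo n (q n)) atTop) ≤
      liminf (fun n => expo n (p n + q n)) atTop := by
  refine le_liminf_expo (fun n => add_nonneg (hp n) (hq n)) 2 0 fun a ha => ?_
  obtain ⟨hap, haq⟩ := lt_min_iff.1 ha
  filter_upwards [eventually_le_of_lt_liminf_expo hp hap,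
    eventually_le_of_lt_liminf_expo hq haq] with n hpn hqn
  rw [polyFactor, pow_zero]
  linarith

end Rates

section EventExponents

variable {U X Y : Type*} [Fintype Y] {n : ℕ} {R₁ R₂ : ℝ} {WY : X → Y → ℝ}

theorem blockProb_nonneg (hW : ∀ x y, 0 ≤ WY x y) (x : Fin n → X) (D : Set (Fin n → Y)) :
    0 ≤ blockProb WY x D :=
  sum_nonneg fun _ _ => Set.indicator_nonneg (fun _ _ => prod_nonneg fun _ _ => hW _ _) _

theorem blockProb_mono (hW : ∀ x y, 0 ≤ WY x y) (x : Fin n → X) {D D' : Set (Fin n → Y)}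
    (h : D ⊆ D') : blockProb WY x D ≤ blockProb WY x D' :=
  sum_le_sum fun y _ =>
    Set.indicator_le_indicator_of_subset h (fun _ => prod_nonneg fun _ _ => hW _ _) y

theorem blockProb_union_le (hW : ∀ x y, 0 ≤ WY x y) (x : Fin n → X) (D D' : Set (Fin n → Y)) :
    blockProb WY x (D ∪ D') ≤ blockProb WY x D + blockProb WY x D' := by
  have hinter : 0 ≤ blockProb WY x (D ∩ D') := blockProb_nonneg hW x _
  have hsum : blockProb WY x (D ∪ D') + blockProb WY x (D ∩ D') =
      blockProb WY x D + blockProb WY x D' := by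
    rw [blockProb, blockProb, ← sum_add_distrib, blockProb, blockProb, ← sum_add_distrib]
    exact sum_congr rfl fun y _ => congrFun (Set.indicator_union_add_inter _ D D') y
  linarith

theorem Code.avg_nonneg {f : Msg n R₁ → Msg n R₂ → ℝ} (h : ∀ m₁ m₂, 0 ≤ f m₁ m₂) :
    0 ≤ Code.avg f := by
  rw [Code.avg_eq_expect]
  exact expect_nonneg fun m _ => h m.1 m.2

theorem Code.avg_mono {f g : Msg n R₁ → Msg n R₂ → ℝ} (h : ∀ m₁ m₂, f m₁ m₂ ≤ g m₁ m₂) :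
    Code.avg f ≤ Code.avg g := by
  rw [Code.avg_eq_expect, Code.avg_eq_expect]
  exact expect_le_expect fun m _ => h m.1 m.2

theorem Code.avg_add (f g : Msg n R₁ → Msg n R₂ → ℝ) :
    Code.avg (fun m₁ m₂ => f m₁ m₂ + g m₁ m₂) = Code.avg f + Code.avg g := by
  simp only [Code.avg_eq_expect, expect_add_distrib]

/-- The exponential rate of decay of the probability, averaged over the messages, that the channel
output lies in `D n m₁ m₂` when the codeword `x m₁ m₂` of the codebook `C n` is sent. -/
def eventExp (WY : X → Y → ℝ) (C : ∀ n, Codebook U X n R₁ R₂)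
    (D : ∀ n, Msg n R₁ → Msg n R₂ → Set (Fin n → Y)) : EReal :=
  liminf (fun n => expo n (Code.avg fun m₁ m₂ => blockProb WY ((C n).x m₁ m₂) (D n m₁ m₂))) atTop

variable {C : ∀ n, Codebook U X n R₁ R₂} {D D' : ∀ n, Msg n R₁ → Msg n R₂ → Set (Fin n → Y)}

theorem eventExp_anti (hW : ∀ x y, 0 ≤ WY x y) (h : ∀ n m₁ m₂, D n m₁ m₂ ⊆ D' n m₁ m₂) :
    eventExp WY C D' ≤ eventExp WY C D :=
  liminf_le_liminf <| .of_forall fun n =>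
    expo_anti (Code.avg_nonneg fun _ _ => blockProb_nonneg hW _ _)
      (Code.avg_mono fun m₁ m₂ => blockProb_mono hW _ (h n m₁ m₂))

theorem min_eventExp_le_eventExp_union (hW : ∀ x y, 0 ≤ WY x y) :
    min (eventExp WY C D) (eventExp WY C D') ≤
      eventExp WY C fun n m₁ m₂ => D n m₁ m₂ ∪ D' n m₁ m₂ := by
  have hnonneg (D : ∀ n, Msg n R₁ → Msg n R₂ → Set (Fin n → Y)) (n : ℕ) :
      0 ≤ Code.avg fun m₁ m₂ => blockProb WY ((C n).x m₁ m₂) (D n m₁ m₂) :=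
    Code.avg_nonneg fun _ _ => blockProb_nonneg hW _ _
  calc min (eventExp WY C D) (eventExp WY C D')
      ≤ liminf (fun n => expo n
          ((Code.avg fun m₁ m₂ => blockProb WY ((C n).x m₁ m₂) (D n m₁ m₂)) +
            Code.avg fun m₁ m₂ => blockProb WY ((C n).x m₁ m₂) (D' n m₁ m₂))) atTop :=
        min_liminf_expo_le_liminf_expo_add (hnonneg D) (hnonneg D')
    _ ≤ _ := liminf_le_liminf <| .of_forall fun n =>
        expo_anti (hnonneg (fun n m₁ m₂ => D n m₁ m₂ ∪ D' n m₁ m₂) n) <|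
          (Code.avg_mono fun m₁ m₂ => blockProb_union_le hW _ _ _).trans_eq (Code.avg_add _ _)

theorem max_eventExp_le_eventExp_inter (hW : ∀ x y, 0 ≤ WY x y) :
    max (eventExp WY C D) (eventExp WY C D') ≤
      eventExp WY C fun n m₁ m₂ => D n m₁ m₂ ∩ D' n m₁ m₂ :=
  max_le (eventExp_anti hW fun _ _ _ => Set.inter_subset_left)
    (eventExp_anti hW fun _ _ _ => Set.inter_subset_right)

end EventExponents

section ErasureTest

variable {M : Type*} {i : M → ℝ} {R S l : ℝ} {m m' : M}

/-- The inequality by which `m` holds its ground against `m'` in an erasure test on the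
statistic `i` with rate `R`, threshold `S` and parameter `l`. Both steps of the decoder look for
the unique message that beats all others. -/
def Beats (i : M → ℝ) (R S l : ℝ) (m m' : M) : Prop :=
  S + l * max (i m' - R) 0 ≤ i m

/-- Some message prevents `m` from passing the erasure test with strict inequalities. -/
def HasRival (i : M → ℝ) (R S l : ℝ) (m : M) : Prop :=
  ∃ m' ≠ m, i m ≤ S + l * max (i m' - R) 0

theorem forall_beats_iff_of_not_hasRival (hS : R ≤ S) (hl : 1 ≤ l) (hm : ¬HasRival i R S l m) :
    (∀ m'' ≠ m', Beats i R S l m' m'') ↔ m' = m := by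
  have hstrict : ∀ m'' ≠ m, S + l * max (i m'' - R) 0 < i m := by
    simpa only [HasRival, not_exists, not_and, not_le] using hm
  refine ⟨fun h => by_contra fun hne => ?_, fun h m'' hne => ?_⟩
  · have hbeat : S + l * max (i m - R) 0 ≤ i m' := h m (Ne.symm hne)
    have hscale : ∀ t : ℝ, max t 0 ≤ l * max t 0 := fun t =>
      le_mul_of_one_le_left (le_max_right t 0) hl
    linarith [hstrict m' hne, hscale (i m - R), hscale (i m' - R), le_max_left (i m - R) 0,
      le_max_left (i m' - R) 0]
  · subst h
    exact (hstrict m'' hne).le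

theorem HasRival.exists_inv_mul_max_le (hl : 1 ≤ l) (h : HasRival i R S l m) :
    ∃ m' ≠ m, 1 / l * max (i m - S) 0 ≤ max (i m' - R) 0 := by
  obtain ⟨m', hne, h⟩ := h
  have hl' : 0 < l := one_pos.trans_le hl
  refine ⟨m', hne, ?_⟩
  rw [one_div, inv_mul_le_iff₀ hl']
  exact max_le (by linarith) (mul_nonneg hl'.le (le_max_right _ _))

theorem Beats.mul_max_add_le (h : Beats i R S l m m') :
    l * max (i m' - R) 0 + (S - R) ≤ max (i m - R) 0 := by
  unfold Beats at h
  linarith [le_max_left (i m - R) 0]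

end ErasureTest

section Decoder

namespace Codebook

variable {U X Y Z : Type*} [Fintype U] [Fintype X] [Fintype Y] {n : ℕ} {R₁ R₂ : ℝ}

section Events

variable (C : Codebook U X n R₁ R₂) (S₁ S₂ l₁₂ l₂ : ℝ) (m₁ : Msg n R₁) (m₂ : Msg n R₂)

/-- The outputs for which the transmitted pair has a rival in Step 1. -/
def rivalPair : Set (Fin n → Y) :=
  {y | HasRival (C.info₁₂ y) (R₁ + R₂) (S₁ + S₂) l₁₂ (m₁, m₂)}

/-- The outputs for which a pair with a wrong first message beats the transmitted one in Step 1. -/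
def wrongPair₁ : Set (Fin n → Y) :=
  {y | ∃ m : Msg n R₁ × Msg n R₂, m.1 ≠ m₁ ∧
    Beats (C.info₁₂ y) (R₁ + R₂) (S₁ + S₂) l₁₂ m (m₁, m₂)}

/-- The outputs for which a pair with a wrong second message beats the transmitted one in
Step 1. -/
def wrongPair₂ : Set (Fin n → Y) :=
  {y | ∃ m : Msg n R₁ × Msg n R₂, m.2 ≠ m₂ ∧
    Beats (C.info₁₂ y) (R₁ + R₂) (S₁ + S₂) l₁₂ m (m₁, m₂)}

/-- The outputs for which the transmitted cloud center has a rival in Step 2. -/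
def rivalCloud : Set (Fin n → Y) :=
  {y | HasRival (C.info₂ y) R₂ S₂ l₂ m₂}

/-- The outputs for which a wrong cloud center beats the transmitted one in Step 2. -/
def wrongCloud : Set (Fin n → Y) :=
  {y | ∃ m ≠ m₂, Beats (C.info₂ y) R₂ S₂ l₂ m m₂}

end Events

variable {C : Codebook U X n R₁ R₂} {S₁ S₂ l₁₂ l₂ : ℝ} {m₁ : Msg n R₁} {m₂ : Msg n R₂}
  {y : Fin n → Y}

theorem twoStep_cases (C : Codebook U X n R₁ R₂) (S₁ S₂ l₁₂ l₂ : ℝ) (y : Fin n → Y) :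
    (∃ m, C.Step₁ S₁ S₂ l₁₂ y m ∧ C.twoStep S₁ S₂ l₁₂ l₂ y = (some m.1, some m.2)) ∨
      (¬∃! m, C.Step₁ S₁ S₂ l₁₂ y m) ∧
        ((∃ m₂, C.Step₂ S₂ l₂ y m₂ ∧ C.twoStep S₁ S₂ l₁₂ l₂ y = (none, some m₂)) ∨
          (¬∃! m₂, C.Step₂ S₂ l₂ y m₂) ∧ C.twoStep S₁ S₂ l₁₂ l₂ y = (none, none)) := by
  unfold twoStep
  split_ifs with h₁ h₂
  · exact .inl ⟨_, h₁.exists.choose_spec, rfl⟩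
  · exact .inr ⟨h₁, .inl ⟨_, h₂.exists.choose_spec, rfl⟩⟩
  · exact .inr ⟨h₁, .inr ⟨h₂, rfl⟩⟩

theorem step₁_iff_of_notMem_rivalPair (hS : R₁ + R₂ ≤ S₁ + S₂) (hl : 1 ≤ l₁₂)
    (hy : y ∉ C.rivalPair S₁ S₂ l₁₂ m₁ m₂) {m : Msg n R₁ × Msg n R₂} :
    C.Step₁ S₁ S₂ l₁₂ y m ↔ m = (m₁, m₂) :=
  forall_beats_iff_of_not_hasRival hS hl hy

theorem mem_rivalPair_of_not_existsUnique (hS : R₁ + R₂ ≤ S₁ + S₂) (hl : 1 ≤ l₁₂)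
    (h : ¬∃! m, C.Step₁ S₁ S₂ l₁₂ y m) : y ∈ C.rivalPair S₁ S₂ l₁₂ m₁ m₂ := by
  by_contra hy
  have hstep := fun m => step₁_iff_of_notMem_rivalPair hS hl hy (m := m)
  exact h ⟨(m₁, m₂), (hstep _).2 rfl, fun m => (hstep m).1⟩

theorem compl_region₁_subset (hS : R₁ + R₂ ≤ S₁ + S₂) (hl : 1 ≤ l₁₂)
    (d : (Fin n → Z) → Option (Msg n R₂)) :
    ((C.code S₁ S₂ l₁₂ l₂ d : Code X Y Z n R₁ R₂).region₁ m₁)ᶜ ⊆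
      C.rivalPair S₁ S₂ l₁₂ m₁ m₂ := by
  intro y (hy : (C.twoStep _ _ _ _ y).1 ≠ some m₁)
  by_contra hr
  rcases C.twoStep_cases S₁ S₂ l₁₂ l₂ y with ⟨m, hm, hdec⟩ | ⟨hnot, -⟩
  · rw [(step₁_iff_of_notMem_rivalPair hS hl hr).1 hm] at hdec
    exact hy (congrArg Prod.fst hdec)
  · exact hr (mem_rivalPair_of_not_existsUnique hS hl hnot)

theorem iUnion_region₁_subset (d : (Fin n → Z) → Option (Msg n R₂)) :
    ⋃ m ∈ {m | m ≠ m₁}, (C.code S₁ S₂ l₁₂ l₂ d : Code X Y Z n R₁ R₂).region₁ m ⊆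
      C.wrongPair₁ S₁ S₂ l₁₂ m₁ m₂ := by
  refine Set.iUnion₂_subset fun m (hne : m ≠ m₁) y (hy : (C.twoStep _ _ _ _ y).1 = some m) => ?_
  rcases C.twoStep_cases S₁ S₂ l₁₂ l₂ y with ⟨m', hm', hdec⟩ | ⟨-, ⟨_, -, hdec⟩ | ⟨-, hdec⟩⟩ <;>
    rw [hdec] at hy
  · obtain rfl := Option.some_injective _ hy
    exact ⟨m', hne, hm' _ fun h => hne (congrArg Prod.fst h).symm⟩
  all_goals exact absurd hy (Option.some_ne_none m).symm

theorem mem_wrongPair₂_of_step₁ {m : Msg n R₁ × Msg n R₂} (hm : C.Step₁ S₁ S₂ l₁₂ y m)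
    (hne : m.2 ≠ m₂) : y ∈ C.wrongPair₂ S₁ S₂ l₁₂ m₁ m₂ :=
  ⟨m, hne, hm _ fun h => hne (congrArg Prod.snd h).symm⟩

omit [Fintype X] in
theorem step₂_iff_of_notMem_rivalCloud (hS : R₂ ≤ S₂) (hl : 1 ≤ l₂)
    (hy : y ∉ C.rivalCloud S₂ l₂ m₂) {m : Msg n R₂} : C.Step₂ S₂ l₂ y m ↔ m = m₂ :=
  forall_beats_iff_of_not_hasRival hS hl hy

theorem compl_region₂_subset (hS₁₂ : R₁ + R₂ ≤ S₁ + S₂) (hS₂ : R₂ ≤ S₂) (hl₁₂ : 1 ≤ l₁₂)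
    (hl₂ : 1 ≤ l₂) (d : (Fin n → Z) → Option (Msg n R₂)) :
    ((C.code S₁ S₂ l₁₂ l₂ d : Code X Y Z n R₁ R₂).region₂ m₂)ᶜ ⊆
      C.wrongPair₂ S₁ S₂ l₁₂ m₁ m₂ ∪ C.rivalPair S₁ S₂ l₁₂ m₁ m₂ ∩ C.rivalCloud S₂ l₂ m₂ := by
  intro y (hy : (C.twoStep _ _ _ _ y).2 ≠ some m₂)
  rcases C.twoStep_cases S₁ S₂ l₁₂ l₂ y with ⟨m, hm, hdec⟩ | ⟨hnot₁, hcloud⟩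
  · rw [hdec] at hy
    exact .inl (mem_wrongPair₂_of_step₁ hm fun h => hy (congrArg some h))
  · refine .inr ⟨mem_rivalPair_of_not_existsUnique hS₁₂ hl₁₂ hnot₁, by_contra fun hr => ?_⟩
    have hstep := fun m => step₂_iff_of_notMem_rivalCloud hS₂ hl₂ hr (m := m)
    rcases hcloud with ⟨m, hm, hdec⟩ | ⟨hnot₂, -⟩
    · rw [(hstep m).1 hm] at hdec
      exact hy (congrArg Prod.snd hdec)
    · exact hnot₂ ⟨m₂, (hstep _).2 rfl, fun m => (hstep m).1⟩

theorem iUnion_region₂_subset (hS₁₂ : R₁ + R₂ ≤ S₁ + S₂) (hl₁₂ : 1 ≤ l₁₂)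
    (d : (Fin n → Z) → Option (Msg n R₂)) :
    ⋃ m ∈ {m | m ≠ m₂}, (C.code S₁ S₂ l₁₂ l₂ d : Code X Y Z n R₁ R₂).region₂ m ⊆
      C.wrongPair₂ S₁ S₂ l₁₂ m₁ m₂ ∪ C.rivalPair S₁ S₂ l₁₂ m₁ m₂ ∩ C.wrongCloud S₂ l₂ m₂ := by
  refine Set.iUnion₂_subset fun m (hne : m ≠ m₂) y (hy : (C.twoStep _ _ _ _ y).2 = some m) => ?_
  rcases C.twoStep_cases S₁ S₂ l₁₂ l₂ y with
      ⟨m', hm', hdec⟩ | ⟨hnot, ⟨m', hm', hdec⟩ | ⟨-, hdec⟩⟩ <;> rw [hdec] at hy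
  · obtain rfl := Option.some_injective _ hy
    exact .inl (mem_wrongPair₂_of_step₁ hm' hne)
  · obtain rfl := Option.some_injective _ hy
    exact .inr ⟨mem_rivalPair_of_not_existsUnique hS₁₂ hl₁₂ hnot, m', hne, hm' m₂ hne.symm⟩
  · exact absurd hy (Option.some_ne_none m).symm

end Codebook

end Decoder

section ScoreBounds

namespace Codebook

variable {U X Y : Type*} [Fintype U] [Fintype X] [Fintype Y] {n : ℕ} {R₁ R₂ : ℝ}
  {C : Codebook U X n R₁ R₂} {m₁ : Msg n R₁} {m₂ : Msg n R₂} {y : Fin n → Y}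

theorem two_rpow_mul_max_le_one_add_sum {ι : Type*} {s : Finset ι} {j : ι} (n : ℕ) (a : ι → ℝ)
    (hj : j ∈ s) : (2 : ℝ) ^ ((n : ℝ) * max (a j) 0) ≤ 1 + ∑ j ∈ s, 2 ^ ((n : ℝ) * a j) := by
  have hpos : ∀ j ∈ s, (0 : ℝ) ≤ 2 ^ ((n : ℝ) * a j) := fun j _ => by positivity
  rcases max_cases (a j) 0 with ⟨h, -⟩ | ⟨h, -⟩ <;> rw [h]
  · exact (single_le_sum hpos hj).trans (le_add_of_nonneg_left zero_le_one)
  · rw [mul_zero, Real.rpow_zero]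
    exact le_add_of_nonneg_right (sum_nonneg hpos)

theorem two_rpow_max_info₁₂_le_score {m : Msg n R₁ × Msg n R₂} (hm : m.2 ≠ m₂) :
    (2 : ℝ) ^ ((n : ℝ) * max (C.info₁₂ y m - (R₁ + R₂)) 0) ≤ C.score m₁ m₂ y := by
  refine (two_rpow_mul_max_le_one_add_sum n (fun m => C.info₁₂ y m - (R₁ + R₂))
    (s := {m | m.2 ≠ m₂}) ((mem_filter_univ m).2 hm)).trans ?_
  rw [score, add_assoc (1 + _)]
  exact le_add_of_nonneg_right (by positivity)

theorem two_rpow_max_info₁₂_sub_info₂_le_score {m : Msg n R₁} (hm : m ≠ m₁) :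
    (2 : ℝ) ^ ((n : ℝ) * max (C.info₁₂ y (m, m₂) - C.info₂ y m₂ - R₁) 0) ≤ C.score m₁ m₂ y := by
  refine (two_rpow_mul_max_le_one_add_sum n (fun m => C.info₁₂ y (m, m₂) - C.info₂ y m₂ - R₁)
    (s := {m | m ≠ m₁}) ((mem_filter_univ m).2 hm)).trans ?_
  rw [score, add_right_comm 1, add_assoc (1 + _)]
  exact le_add_of_nonneg_right (by positivity)

theorem two_rpow_max_info₂_le_score {m : Msg n R₂} (hm : m ≠ m₂) :
    (2 : ℝ) ^ ((n : ℝ) * max (C.info₂ y m - R₂) 0) ≤ C.score m₁ m₂ y := by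
  refine (two_rpow_mul_max_le_one_add_sum n (fun m => C.info₂ y m - R₂)
    (s := {m | m ≠ m₂}) ((mem_filter_univ m).2 hm)).trans ?_
  rw [score, add_assoc 1]
  gcongr
  exact le_add_of_nonneg_right (by positivity)

theorem two_rpow_max_info₁₂_sub_max_info₂_le_score {m : Msg n R₁ × Msg n R₂}
    (hm : m ≠ (m₁, m₂)) :
    (2 : ℝ) ^ ((n : ℝ) * (max (C.info₁₂ y m - (R₁ + R₂)) 0 - max (C.info₂ y m₂ - R₂) 0)) ≤
      C.score m₁ m₂ y := by
  by_cases hm₂ : m.2 = m₂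
  · obtain ⟨m, m'⟩ := m
    obtain rfl : m' = m₂ := hm₂
    refine le_trans ?_ (two_rpow_max_info₁₂_sub_info₂_le_score fun h => hm (Prod.ext h rfl))
    gcongr
    · exact one_le_two
    · rw [sub_le_iff_le_add]
      refine max_le ?_ (by positivity)
      linarith [le_max_left (C.info₁₂ y (m, m') - C.info₂ y m' - R₁) 0,
        le_max_left (C.info₂ y m' - R₂) 0]
  · refine le_trans ?_ (two_rpow_max_info₁₂_le_score hm₂)
    gcongr
    · exact one_le_two
    · exact sub_le_self _ (le_max_right _ _)

end Codebook

end ScoreBounds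

section GoodCodebooks

variable {U X Y : Type*} [Fintype U] [Fintype X] [Fintype Y] {R₁ R₂ : ℝ}

variable (Y) in
/-- A sequence of codebooks of constant joint types `T n` converging to `P`, with subexponential
mean scores for the output alphabet `Y`. Such a sequence attains all the exponents of the
theorem. -/
structure IsGood (C : ∀ n, Codebook U X n R₁ R₂) (T : ℕ → U × X → ℝ) (P : U × X → ℝ) : Prop where
  seqType_eq : ∀ n m₁ m₂, seqType (pairSeq ((C n).u m₂) ((C n).x m₁ m₂)) = T n
  tendsto : Tendsto T atTop (𝓝 P)
  meanScore_le : ∀ n, (C n).meanScore Y ≤ 9 * polyFactor n (2 * codeDegree U X Y)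

theorem exists_isGood (P : stdSimplex ℝ (U × X)) (hR₁ : 0 ≤ R₁) (hR₂ : 0 ≤ R₂) :
    ∃ (C : ∀ n, Codebook U X n R₁ R₂) (T : ℕ → U × X → ℝ), IsGood Y C T P := by
  obtain ⟨s, hs⟩ := exists_seqType_tendsto P
  choose C hC hscore using fun n => exists_codebook_meanScore_le (Y := Y)
    (fun i => (s n i).1) (fun i => (s n i).2) hR₁ hR₂
  exact ⟨C, fun n => seqType (s n), hC, hs, hscore⟩

theorem Codebook.score_nonneg {n : ℕ} (C : Codebook U X n R₁ R₂) (m₁ : Msg n R₁) (m₂ : Msg n R₂)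
    (y : Fin n → Y) : 0 ≤ C.score m₁ m₂ y := by
  unfold Codebook.score
  positivity

variable [Nonempty Y] {WY : X → Y → ℝ} {Φ : ((U × X) × Y → ℝ) → ℝ}

theorem blockProb_le_sum_weight_mul_score {n : ℕ} (hW : ∀ x y, 0 ≤ WY x y)
    {C : Codebook U X n R₁ R₂} {m₁ : Msg n R₁} {m₂ : Msg n R₂} {E : ℝ}
    (hE : E ≤ jointExponent (chanUX WY) Φ (seqType (pairSeq (C.u m₂) (C.x m₁ m₂))))
    {D : Set (Fin n → Y)}
    (hD : ∀ y ∈ D, (2 : ℝ) ^ ((n : ℝ) *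
      Φ (seqType (pairSeq (pairSeq (C.u m₂) (C.x m₁ m₂)) y))) ≤ C.score m₁ m₂ y) :
    blockProb WY (C.x m₁ m₂) D ≤
      (∑ y : Fin n → Y, C.weight m₁ m₂ y * C.score m₁ m₂ y) * 2 ^ (-((n : ℝ) * E)) := by
  rw [blockProb, sum_mul]
  refine sum_le_sum fun y _ => Set.indicator_apply_le' (fun hy => ?_) fun _ => ?_
  · calc ∏ i, WY (C.x m₁ m₂ i) (y i)
        ≤ C.weight m₁ m₂ y * 2 ^ ((n : ℝ) *
            (Φ (seqType (pairSeq (pairSeq (C.u m₂) (C.x m₁ m₂)) y)) - E)) :=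
          prod_le_condLik_mul (W := chanUX WY) (fun p => hW p.2) hE y
      _ = C.weight m₁ m₂ y * 2 ^ ((n : ℝ) *
            Φ (seqType (pairSeq (pairSeq (C.u m₂) (C.x m₁ m₂)) y))) * 2 ^ (-((n : ℝ) * E)) := by
          rw [mul_assoc, ← Real.rpow_add two_pos, mul_sub, sub_eq_add_neg]
      _ ≤ C.weight m₁ m₂ y * C.score m₁ m₂ y * 2 ^ (-((n : ℝ) * E)) := by
          gcongr
          · exact (C.weight_pos m₁ m₂ y).le
          · exact hD y hy
  · exact mul_nonneg (mul_nonneg (C.weight_pos m₁ m₂ y).le (C.score_nonneg m₁ m₂ y)) (by positivity)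

namespace IsGood

variable {C : ∀ n, Codebook U X n R₁ R₂} {T : ℕ → U × X → ℝ} {P : U × X → ℝ}

omit [Nonempty Y] in
theorem type_nonneg (hC : IsGood Y C T P) (n : ℕ) : 0 ≤ T n := by
  rw [← hC.seqType_eq n (Classical.arbitrary _) (Classical.arbitrary _)]
  exact seqType_nonneg _

omit [Nonempty Y] in
theorem nonneg (hC : IsGood Y C T P) : 0 ≤ P :=
  ge_of_tendsto' hC.tendsto hC.type_nonneg

theorem avg_blockProb_le (hC : IsGood Y C T P) (hW : ∀ x y, 0 ≤ WY x y) {n : ℕ} {E : ℝ}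
    (hE : E ≤ jointExponent (chanUX WY) Φ (T n)) {D : Msg n R₁ → Msg n R₂ → Set (Fin n → Y)}
    (hD : ∀ m₁ m₂, ∀ y ∈ D m₁ m₂, (2 : ℝ) ^ ((n : ℝ) *
      Φ (seqType (pairSeq (pairSeq ((C n).u m₂) ((C n).x m₁ m₂)) y))) ≤ (C n).score m₁ m₂ y) :
    (Code.avg fun m₁ m₂ => blockProb WY ((C n).x m₁ m₂) (D m₁ m₂)) ≤
      9 * polyFactor n (2 * codeDegree U X Y) * 2 ^ (-((n : ℝ) * E)) := by
  calc (Code.avg fun m₁ m₂ => blockProb WY ((C n).x m₁ m₂) (D m₁ m₂))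
      ≤ Code.avg fun m₁ m₂ =>
          (∑ y : Fin n → Y, (C n).weight m₁ m₂ y * (C n).score m₁ m₂ y) * 2 ^ (-((n : ℝ) * E)) :=
        Code.avg_mono fun m₁ m₂ =>
          blockProb_le_sum_weight_mul_score hW (by rwa [hC.seqType_eq]) (hD m₁ m₂)
    _ = (C n).meanScore Y * 2 ^ (-((n : ℝ) * E)) := by
        simp only [Codebook.meanScore, Code.avg_eq_expect, expect_mul]
    _ ≤ _ := mul_le_mul_of_nonneg_right (hC.meanScore_le n) (by positivity)

theorem jointExponent_le_eventExp (hC : IsGood Y C T P) (hW : ∀ x y, 0 ≤ WY x y)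
    (hΦ : ContinuousOn Φ (Set.Ici 0)) {D : ∀ n, Msg n R₁ → Msg n R₂ → Set (Fin n → Y)}
    (hD : ∀ n m₁ m₂, ∀ y ∈ D n m₁ m₂, (2 : ℝ) ^ ((n : ℝ) *
      Φ (seqType (pairSeq (pairSeq ((C n).u m₂) ((C n).x m₁ m₂)) y))) ≤ (C n).score m₁ m₂ y) :
    jointExponent (chanUX WY) Φ P ≤ eventExp WY C D := by
  have htendsto : Tendsto T atTop (𝓝[Set.Ici 0] P) :=
    tendsto_nhdsWithin_iff.2 ⟨hC.tendsto, .of_forall hC.type_nonneg⟩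
  refine le_liminf_expo (fun n => Code.avg_nonneg fun _ _ => blockProb_nonneg hW _ _)
    9 (2 * codeDegree U X Y) fun a ha => ?_
  filter_upwards [htendsto.eventually
    (lowerSemicontinuousOn_jointExponent (chanUX WY) hΦ P hC.nonneg a ha)] with n hn
  exact hC.avg_blockProb_le hW hn.le (hD n)

theorem jointExponent_add_le_eventExp (hC : IsGood Y C T P) (hW : ∀ x y, 0 ≤ WY x y)
    (hΦ : ContinuousOn Φ (Set.Ici 0)) {c : ℝ} {D : ∀ n, Msg n R₁ → Msg n R₂ → Set (Fin n → Y)}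
    (hD : ∀ n m₁ m₂, ∀ y ∈ D n m₁ m₂, (2 : ℝ) ^ ((n : ℝ) *
      (Φ (seqType (pairSeq (pairSeq ((C n).u m₂) ((C n).x m₁ m₂)) y)) + c)) ≤
        (C n).score m₁ m₂ y) :
    jointExponent (chanUX WY) Φ P + c ≤ eventExp WY C D :=
  (jointExponent_add_le _ Φ c P).trans <|
    hC.jointExponent_le_eventExp hW (hΦ.add continuousOn_const) hD

variable {S₁ S₂ l₁₂ l₂ : ℝ}

theorem ErPen_le_eventExp_rivalPair (hC : IsGood Y C T P) (hW : ∀ x y, 0 ≤ WY x y)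
    (hl : 1 ≤ l₁₂) :
    ErPen P WY (1 / l₁₂) S₁ S₂ R₂ ≤
      eventExp WY C fun n => (C n).rivalPair S₁ S₂ l₁₂ := by
  refine hC.jointExponent_le_eventExp hW
    (Φ := fun Q => 1 / l₁₂ * J₂ Q (S₁ + S₂) - J₂ (margUY Q) R₂)
    (((continuousOn_J₂ (S₁ + S₂)).const_mul (1 / l₁₂)).sub (continuousOn_J₂_margUY R₂))
    fun n m₁ m₂ y hy => ?_
  obtain ⟨m, hm, hrival⟩ := HasRival.exists_inv_mul_max_le hl hy
  refine le_trans ?_ (Codebook.two_rpow_max_info₁₂_sub_max_info₂_le_score hm)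
  rw [margUY_seqType]
  gcongr
  · exact one_le_two
  · exact hrival
  · exact le_rfl

theorem ErPen_add_le_eventExp_wrongPair₁ (hC : IsGood Y C T P) (hW : ∀ x y, 0 ≤ WY x y) :
    ErPen P WY l₁₂ R₁ R₂ R₂ + ((S₁ + S₂ - (R₁ + R₂) : ℝ) : EReal) ≤
      eventExp WY C fun n => (C n).wrongPair₁ S₁ S₂ l₁₂ := by
  refine hC.jointExponent_add_le_eventExp hW
    (Φ := fun Q => l₁₂ * J₂ Q (R₁ + R₂) - J₂ (margUY Q) R₂)
    (((continuousOn_J₂ (R₁ + R₂)).const_mul l₁₂).sub (continuousOn_J₂_margUY R₂))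
    fun n m₁ m₂ y ⟨m, hm, hbeats⟩ => ?_
  refine le_trans ?_ (Codebook.two_rpow_max_info₁₂_sub_max_info₂_le_score
    fun h => hm (congrArg Prod.fst h))
  rw [margUY_seqType, sub_add_eq_add_sub]
  gcongr
  · exact one_le_two
  · exact hbeats.mul_max_add_le
  · exact le_rfl

theorem Er₁₂_add_le_eventExp_wrongPair₂ (hC : IsGood Y C T P) (hW : ∀ x y, 0 ≤ WY x y) :
    Er₁₂ P WY l₁₂ R₁ R₂ + ((S₁ + S₂ - (R₁ + R₂) : ℝ) : EReal) ≤
      eventExp WY C fun n => (C n).wrongPair₂ S₁ S₂ l₁₂ := by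
  refine hC.jointExponent_add_le_eventExp hW (Φ := fun Q => l₁₂ * J₂ Q (R₁ + R₂))
    ((continuousOn_J₂ (R₁ + R₂)).const_mul l₁₂) fun n m₁ m₂ y ⟨m, hm, hbeats⟩ => ?_
  refine le_trans ?_ (Codebook.two_rpow_max_info₁₂_le_score hm)
  gcongr
  · exact one_le_two
  · exact hbeats.mul_max_add_le

theorem Er₂_le_eventExp_rivalCloud (hC : IsGood Y C T P) (hW : ∀ x y, 0 ≤ WY x y)
    (hl : 1 ≤ l₂) :
    Er₂ P WY (1 / l₂) S₂ ≤ eventExp WY C fun n _ => (C n).rivalCloud S₂ l₂ := by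
  refine (jointExponent_chanU_le hC.nonneg hW fun Q => 1 / l₂ * J₂ Q S₂).trans <|
    hC.jointExponent_le_eventExp hW ((continuousOn_J₂_margUY S₂).const_mul (1 / l₂))
    fun n m₁ m₂ y hy => ?_
  obtain ⟨m, hm, hrival⟩ := HasRival.exists_inv_mul_max_le hl hy
  refine le_trans ?_ (Codebook.two_rpow_max_info₂_le_score hm)
  rw [margUY_seqType]
  gcongr
  · exact one_le_two
  · exact hrival

theorem Er₂_add_le_eventExp_wrongCloud (hC : IsGood Y C T P) (hW : ∀ x y, 0 ≤ WY x y) :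
    Er₂ P WY l₂ R₂ + ((S₂ - R₂ : ℝ) : EReal) ≤
      eventExp WY C fun n _ => (C n).wrongCloud S₂ l₂ := by
  refine (add_le_add_left
    (jointExponent_chanU_le hC.nonneg hW fun Q => l₂ * J₂ Q R₂) _).trans <|
      hC.jointExponent_add_le_eventExp hW ((continuousOn_J₂_margUY R₂).const_mul l₂)
        fun n m₁ m₂ y ⟨m, hm, hbeats⟩ => ?_
  refine le_trans ?_ (Codebook.two_rpow_max_info₂_le_score hm)
  rw [margUY_seqType]
  gcongr
  · exact one_le_two
  · exact hbeats.mul_max_add_le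

end IsGood

end GoodCodebooks

theorem margY_nonneg {X Y Z : Type*} [Fintype Y] [Fintype Z] (W : X → stdSimplex ℝ (Y × Z))
    (x : X) (y : Y) : 0 ≤ margY W x y :=
  sum_nonneg fun z _ => (W x).2.1 (y, z)

end ABC

end

theorem theorem1 {U X Y Z : Type*} [Fintype U] [Fintype X] [Fintype Y] [Fintype Z]
    (W : X → stdSimplex ℝ (Y × Z)) (P : stdSimplex ℝ (U × X))
    (R₁ R₂ : ℝ) (hR₁ : 0 ≤ R₁) (hR₂ : 0 ≤ R₂) :
    ∃ C : ∀ n : ℕ, ABC.Codebook U X n R₁ R₂,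
      -- the codebooks have constant joint composition, converging to `P`
      (∃ T : ℕ → U × X → ℝ,
        (∀ n m₁ m₂, ABC.seqType (ABC.pairSeq ((C n).u m₂) ((C n).x m₁ m₂)) = T n) ∧
        Tendsto T atTop (𝓝 (P : U × X → ℝ))) ∧
      ∀ (S₁ S₂ l₁₂ l₂ : ℝ), R₁ ≤ S₁ → R₂ ≤ S₂ → 1 ≤ l₁₂ → 1 ≤ l₂ →
      ∀ c : ∀ n : ℕ, ABC.Code X Y Z n R₁ R₂,
        (∀ n, ∃ φ : (Fin n → Z) → Option (ABC.Msg n R₂),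
          c n = (C n).code S₁ S₂ l₁₂ l₂ φ) →
        ABC.ErPen P (ABC.margY W) (1 / l₁₂) S₁ S₂ R₂ ≤
          liminf (fun n => ABC.expo n ((c n).totalErr₁ (ABC.margY W))) atTop ∧
        ABC.ErPen P (ABC.margY W) l₁₂ R₁ R₂ R₂ + (((S₁ + S₂) - (R₁ + R₂) : ℝ) : EReal) ≤
          liminf (fun n => ABC.expo n ((c n).undetErr₁ (ABC.margY W))) atTop ∧
        min (ABC.Er₁₂ P (ABC.margY W) l₁₂ R₁ R₂ + (((S₁ + S₂) - (R₁ + R₂) : ℝ) : EReal))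
            (max (ABC.ErPen P (ABC.margY W) (1 / l₁₂) S₁ S₂ R₂)
              (ABC.Er₂ P (ABC.margY W) (1 / l₂) S₂)) ≤
          liminf (fun n => ABC.expo n ((c n).totalErr₂ (ABC.margY W))) atTop ∧
        min (ABC.Er₁₂ P (ABC.margY W) l₁₂ R₁ R₂ + (((S₁ + S₂) - (R₁ + R₂) : ℝ) : EReal))
            (max (ABC.ErPen P (ABC.margY W) (1 / l₁₂) S₁ S₂ R₂)
              (ABC.Er₂ P (ABC.margY W) l₂ R₂ + ((S₂ - R₂ : ℝ) : EReal))) ≤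
          liminf (fun n => ABC.expo n ((c n).undetErr₂ (ABC.margY W))) atTop := by
  have hW : ∀ x y, 0 ≤ ABC.margY W x y := ABC.margY_nonneg W
  obtain ⟨p⟩ := ABC.nonempty_of_stdSimplex P
  obtain ⟨q⟩ := ABC.nonempty_of_stdSimplex (W p.2)
  have : Nonempty Y := ⟨q.1⟩
  obtain ⟨C, T, hC⟩ := ABC.exists_isGood (Y := Y) P hR₁ hR₂
  refine ⟨C, ⟨T, hC.seqType_eq, hC.tendsto⟩, fun S₁ S₂ l₁₂ l₂ hS₁ hS₂ hl₁₂ hl₂ c hc => ?_⟩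
  choose φ hφ using hc
  obtain rfl : c = fun n => (C n).code S₁ S₂ l₁₂ l₂ (φ n) := funext hφ
  have hS₁₂ : R₁ + R₂ ≤ S₁ + S₂ := add_le_add hS₁ hS₂
  have hrival := hC.ErPen_le_eventExp_rivalPair (S₁ := S₁) (S₂ := S₂) hW hl₁₂
  have hwrong₂ := hC.Er₁₂_add_le_eventExp_wrongPair₂ (S₁ := S₁) (S₂ := S₂) (l₁₂ := l₁₂) hW
  refine ⟨?_, ?_, ?_, ?_⟩
  · exact hrival.trans <| ABC.eventExp_anti hW fun n _ _ =>
      ABC.Codebook.compl_region₁_subset hS₁₂ hl₁₂ (φ n)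
  · exact (hC.ErPen_add_le_eventExp_wrongPair₁ hW).trans <| ABC.eventExp_anti hW fun n _ _ =>
      ABC.Codebook.iUnion_region₁_subset (φ n)
  · exact (min_le_min hwrong₂ <| (max_le_max hrival (hC.Er₂_le_eventExp_rivalCloud hW hl₂)).trans
      (ABC.max_eventExp_le_eventExp_inter hW)).trans <|
        (ABC.min_eventExp_le_eventExp_union hW).trans <| ABC.eventExp_anti hW fun n _ _ =>
          ABC.Codebook.compl_region₂_subset hS₁₂ hS₂ hl₁₂ hl₂ (φ n)
  · exact (min_le_min hwrong₂ <| (max_le_max hrival (hC.Er₂_add_le_eventExp_wrongCloud hW)).trans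
      (ABC.max_eventExp_le_eventExp_inter hW)).trans <|
        (ABC.min_eventExp_le_eventExp_union hW).trans <| ABC.eventExp_anti hW fun n _ _ =>
          ABC.Codebook.iUnion_region₂_subset hS₁₂ hl₁₂ (φ n)
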